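/- Let $\mathbb D$ be an infinite set of data values. A finite data word over a finite alphabet $\mathbb A$ is a pair $w=(\mathbf a,\mathbf d)$ of maps $\mathbf a:\{1,\dots,n\}\to\mathbb A$ and $\mathbf d:\{1,\dots,n\}\to\mathbb D$ with $n\ge 1$. For an operator $\mathrm{op}\in\{\exists_<^\downarrow,\forall_\ge^\downarrow\}$, the formulas of the one-register logic $\mathsf{LTL}^\downarrow_{\mathsf{nnf}}(\mathsf F,\mathsf G,\mathrm{op})$ are given by $$\varphi ::= a \mid \lnot a \mid {\uparrow} \mid \lnot{\uparrow} \mid {\downarrow}\varphi \mid \mathsf F\varphi \mid \mathsf G\varphi \mid \mathrm{op}\,\varphi \mid \varphi\land\varphi \mid \varphi\lor\varphi \qquad (a\in\mathbb A).$$ Truth of $\varphi$ at position $i$ of $w$ with register content $d\in\mathbb D$, written $(w,i)\models^d\varphi$, is defined as follows (negated atoms and the Boolean connectives are interpreted as usual): - $(w,i)\models^d a$ iff $\mathbf a(i)=a$; - $(w,i)\models^d{\uparrow}$ iff $d=\mathbf d(i)$; - $(w,i)\models^d{\downarrow}\varphi$ iff $(w,i)\models^{\mathbf d(i)}\varphi$;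 - $(w,i)\models^d\mathsf F\varphi$ (resp. $\mathsf G\varphi$) iff $(w,j)\models^d\varphi$ for some (resp. every) $j$ with $i\le j\le n$; - $(w,i)\models^d\exists_<^\downarrow\varphi$ iff $(w,i)\models^{\mathbf d(j)}\varphi$ for some $j$ with $1\le j<i$; - $(w,i)\models^d\forall_\ge^\downarrow\varphi$ iff $(w,i)\models^{\mathbf d(j)}\varphi$ for every $j$ with $i\le j\le n$. The satisfiability problem asks, given a finite alphabet $\mathbb A$ and a formula $\varphi$ over $\mathbb A$, whether there is a finite data word $w$ over $\mathbb A$ and $\mathbb D$ with $(w,1)\models^{\mathbf d(1)}\varphi$. **Theorem.** (1) The satisfiability problem of $\mathsf{LTL}^\downarrow_{\mathsf{nnf}}(\mathsf F,\mathsf G,\exists_<^\downarrow)$ is undecidable. (2) The satisfiability problem of $\mathsf{LTL}^\downarrow_{\mathsf{nnf}}(\mathsf F,\mathsf G,\forall_\ge^\downarrow)$ is undecidable. -/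

import Mathlib

namespace RegLTL

/-- The two quantifiers over data values: `existsPast` is `∃_<^↓` (some data value occurring
strictly before the current position), `forallFuture` is `∀_≥^↓` (every data value occurring at
the current position or later). -/
inductive DataQuantifier
  | existsPast
  | forallFuture

/-- Formulas, in negation normal form, of linear temporal logic with one register and with the
operators `F`, `G` and `op`. Letters are natural numbers; the alphabet of size `n` is
`{0, …, n - 1}`. -/
inductive Formula (op : DataQuantifier) : Type
  | letter (a : ℕ) : Formula op
  | notLetter (a : ℕ) : Formula op
  /-- `↑` -/
  | test : Formula op
  /-- `¬↑` -/
  | notTest : Formula op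
  /-- `↓ φ` -/
  | freeze (φ : Formula op) : Formula op
  /-- `F φ` -/
  | future (φ : Formula op) : Formula op
  /-- `G φ` -/
  | globally (φ : Formula op) : Formula op
  /-- `op φ` -/
  | quant (φ : Formula op) : Formula op
  | and (φ ψ : Formula op) : Formula op
  | or (φ ψ : Formula op) : Formula op

/-- A finite data word with at least one position, over the alphabet `{0, …, n - 1}` and the
data domain `D`. -/
structure DataWord (n : ℕ) (D : Type*) where
  len : ℕ
  len_pos : 0 < len
  letter : Fin len → Fin n
  datum : Fin len → D

/-- The first position of a data word. -/
def DataWord.first {n : ℕ} {D : Type*} (w : DataWord n D) : Fin w.len := ⟨0, w.len_pos⟩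

/-- `op.Ranges w i P`: the property `P` of data values holds for some data value before, or for
every data value at or after, position `i`. -/
def DataQuantifier.Ranges {n : ℕ} {D : Type*} (op : DataQuantifier) (w : DataWord n D)
    (i : Fin w.len) (P : D → Prop) : Prop :=
  match op with
  | existsPast => ∃ j, j < i ∧ P (w.datum j)
  | forallFuture => ∀ j, i ≤ j → P (w.datum j)

namespace Formula

variable {op : DataQuantifier}

/-- `φ.Holds w i d`: the formula `φ` is true at position `i` of the data word `w` when the
register contains `d`. -/
def Holds {n : ℕ} {D : Type*} (w : DataWord n D) : Formula op → Fin w.len → D → Prop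
  | letter a, i, _ => (w.letter i : ℕ) = a
  | notLetter a, i, _ => (w.letter i : ℕ) ≠ a
  | test, i, d => d = w.datum i
  | notTest, i, d => d ≠ w.datum i
  | freeze φ, i, _ => φ.Holds w i (w.datum i)
  | future φ, i, d => ∃ j, i ≤ j ∧ φ.Holds w j d
  | globally φ, i, d => ∀ j, i ≤ j → φ.Holds w j d
  | quant φ, i, _ => op.Ranges w i fun d => φ.Holds w i d
  | and φ ψ, i, d => φ.Holds w i d ∧ ψ.Holds w i d
  | or φ ψ, i, d => φ.Holds w i d ∨ ψ.Holds w i d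

/-- All letters of the formula belong to the alphabet `{0, …, n - 1}`. -/
def OverAlphabet (n : ℕ) : Formula op → Prop
  | letter a => a < n
  | notLetter a => a < n
  | test => True
  | notTest => True
  | freeze φ => φ.OverAlphabet n
  | future φ => φ.OverAlphabet n
  | globally φ => φ.OverAlphabet n
  | quant φ => φ.OverAlphabet n
  | and φ ψ => φ.OverAlphabet n ∧ ψ.OverAlphabet n
  | or φ ψ => φ.OverAlphabet n ∧ ψ.OverAlphabet n

/-- The formula is true in some data word over `{0, …, n - 1}` and `D`, evaluated at the first
position with the first datum in the register. -/
def Satisfiable (D : Type*) (n : ℕ) (φ : Formula op) : Prop :=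
  ∃ w : DataWord n D, φ.Holds w w.first (w.datum w.first)

/-- Gödel number of a formula. -/
def toNat : Formula op → ℕ
  | test => 0
  | notTest => 1
  | letter a => 8 * a + 0 + 2
  | notLetter a => 8 * a + 1 + 2
  | freeze φ => 8 * φ.toNat + 2 + 2
  | future φ => 8 * φ.toNat + 3 + 2
  | globally φ => 8 * φ.toNat + 4 + 2
  | quant φ => 8 * φ.toNat + 5 + 2
  | and φ ψ => 8 * Nat.pair φ.toNat ψ.toNat + 6 + 2
  | or φ ψ => 8 * Nat.pair φ.toNat ψ.toNat + 7 + 2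

/-- The formula with a given Gödel number. -/
def ofNat (op : DataQuantifier) : ℕ → Formula op
  | 0 => test
  | 1 => notTest
  | k + 2 =>
    have h : k / 8 < k + 2 := by omega
    have h1 : (k / 8).unpair.1 < k + 2 := lt_of_le_of_lt (Nat.unpair_left_le _) h
    have h2 : (k / 8).unpair.2 < k + 2 := lt_of_le_of_lt (Nat.unpair_right_le _) h
    match k % 8 with
    | 0 => letter (k / 8)
    | 1 => notLetter (k / 8)
    | 2 => freeze (ofNat op (k / 8))
    | 3 => future (ofNat op (k / 8))
    | 4 => globally (ofNat op (k / 8))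
    | 5 => quant (ofNat op (k / 8))
    | 6 => and (ofNat op (k / 8).unpair.1) (ofNat op (k / 8).unpair.2)
    | _ => or (ofNat op (k / 8).unpair.1) (ofNat op (k / 8).unpair.2)

theorem ofNat_toNat (φ : Formula op) : ofNat op φ.toNat = φ := by
  have e (x r : ℕ) (hr : r < 8) : (8 * x + r) / 8 = x ∧ (8 * x + r) % 8 = r := by omega
  induction φ with
  | test => simp [toNat, ofNat]
  | notTest => simp [toNat, ofNat]
  | letter a => rw [toNat, ofNat]; simp
  | notLetter a => rw [toNat, ofNat]; simp [e a 1 (by omega)]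
  | freeze φ ih => rw [toNat, ofNat]; simp [e φ.toNat 2 (by omega), ih]
  | future φ ih => rw [toNat, ofNat]; simp [e φ.toNat 3 (by omega), ih]
  | globally φ ih => rw [toNat, ofNat]; simp [e φ.toNat 4 (by omega), ih]
  | quant φ ih => rw [toNat, ofNat]; simp [e φ.toNat 5 (by omega), ih]
  | and φ ψ ih1 ih2 =>
    rw [toNat, ofNat]; simp [e (Nat.pair φ.toNat ψ.toNat) 6 (by omega), ih1, ih2]
  | or φ ψ ih1 ih2 =>
    rw [toNat, ofNat]; simp [e (Nat.pair φ.toNat ψ.toNat) 7 (by omega), ih1, ih2]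

theorem toNat_ofNat (k : ℕ) : (ofNat op k).toNat = k := by
  induction k using Nat.strong_induction_on with
  | _ k ih =>
    match k with
    | 0 => simp [toNat, ofNat]
    | 1 => simp [toNat, ofNat]
    | k + 2 =>
      have h : k / 8 < k + 2 := by omega
      have i0 := ih _ h
      have i1 := ih _ (lt_of_le_of_lt (Nat.unpair_left_le (k / 8)) h)
      have i2 := ih _ (lt_of_le_of_lt (Nat.unpair_right_le (k / 8)) h)
      have hk := Nat.div_add_mod k 8
      have hlt := Nat.mod_lt k (show 8 > 0 by omega)
      rw [ofNat]
      generalize k % 8 = r at hk hlt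
      interval_cases r <;> simp only [toNat, i0, i1, i2, Nat.pair_unpair] <;> omega

/-- Formulas are identified with natural numbers through their Gödel numbers; this is the
encoding with respect to which computability is understood. -/
instance : Denumerable (Formula op) :=
  Denumerable.mk' ⟨toNat, ofNat op, ofNat_toNat, toNat_ofNat⟩

end Formula

/-- The satisfiability problem on finite data words with data domain `D`. The instances are
pairs of an alphabet `{0, …, n - 1}` and a formula over this alphabet. -/
def SatProblem (D : Type*) (op : DataQuantifier) (p : ℕ × Formula op) : Prop :=
  p.2.OverAlphabet p.1 ∧ p.2.Satisfiable D p.1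

end RegLTL

/-! Both logics can describe the halting runs of a counter machine. One machine `G` suffices
(`exists_not_computablePred_halts`): it computes a universal partial recursive function, so only its
input `n` varies, the alphabet is fixed, and only the subformula `input` depends on `n`.

A run is a sequence of visits of nodes, each with its own datum. To point at the successor of a
visit with only `F` and `G`, the datum of the visit is repeated under `link` once the next visit has
been announced. A visit with another datum that still has this `link` ahead must be a legal
successor, and the first visit with another datum is of this kind (`exists_follows`). The value of a
counter is the number of its increments not yet cancelled: a decrement cancels the datum of one
earlier increment, `mark` forces all cancellations during one visit to share a datum, and a zero
test requires all earlier increments to be cancelled before it.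

These conditions look ahead and form `core`. One condition looks back: a cancelled datum must stem
from an earlier increment of the same counter. Only `backward`, which states this, uses the data
quantifier; the rest is common to both cases. `halts_of_satisfiable` reads a run off any model, in
which visits may be repeated; `satisfiable_of_halts` writes a canonical word for a run, where the
decrements of a counter cancel its increments in order. -/

namespace RegLTL

/-! ### Closure properties of regular languages -/

section Regular

variable {α : Type*} {L M : Language α}

/-- Myhill–Nerode: the quotient of `L * M` by `x` consists of `(L/x) * M` and of the `M/b` for
splittings `x = a ++ b` with `a ∈ L`. It is thus determined by one quotient of `L` and a set of
quotients of `M`, which leaves finitely many possibilities. -/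
theorem isRegular_mul (hL : L.IsRegular) (hM : M.IsRegular) : (L * M).IsRegular := by
  rw [Language.isRegular_iff_finite_range_leftQuotient] at *
  refine ((hL.prod hM.finite_subsets).image
    fun p : Language α × Set (Language α) => p.1 * M + ⨆ K : p.2, (K : Language α)).subset ?_
  rintro _ ⟨x, rfl⟩
  refine ⟨(L.leftQuotient x, {K | ∃ a b, a ++ b = x ∧ a ∈ L ∧ K = M.leftQuotient b}),
    ⟨⟨x, rfl⟩, ?_⟩, ?_⟩
  · rintro _ ⟨a, b, -, -, rfl⟩
    exact ⟨b, rfl⟩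
  · ext y
    simp only [Language.mem_add, Language.mem_iSup, Language.mem_leftQuotient, Language.mem_mul]
    constructor
    · rintro (⟨a, ha, b, hb, rfl⟩ | ⟨⟨_, a, b, rfl, ha, rfl⟩, hy⟩)
      · exact ⟨x ++ a, ha, b, hb, by simp⟩
      · exact ⟨a, ha, b ++ y, hy, by simp⟩
    · rintro ⟨a, ha, b, hb, hab⟩
      rcases List.append_eq_append_iff.1 hab with ⟨c, rfl, rfl⟩ | ⟨c, rfl, rfl⟩
      · exact .inr ⟨⟨_, a, c, rfl, ha, rfl⟩, hb⟩
      · exact .inl ⟨c, ha, b, hb, rfl⟩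

-- For `x ≠ []` the quotient by `x` is `K * L∗`, where `K` is the union of the `L/b` over splittings
-- `x = a ++ b` with `a ∈ L∗`: here `b` is the piece of `x` inside the factor in which `x` ends.
open Computability in
theorem isRegular_kstar (hL : L.IsRegular) : (L∗).IsRegular := by
  rw [Language.isRegular_iff_finite_range_leftQuotient] at *
  refine (((hL.finite_subsets).image
    fun p : Set (Language α) => (⨆ K : p, (K : Language α)) * L∗).union
    (Set.finite_singleton (L∗))).subset ?_
  rintro _ ⟨x, rfl⟩
  by_cases hx : x = []
  · subst hx; exact .inr rfl
  left
  refine ⟨{K | ∃ a b, a ++ b = x ∧ a ∈ L∗ ∧ K = L.leftQuotient b}, ?_, ?_⟩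
  · rintro _ ⟨a, b, -, -, rfl⟩
    exact ⟨b, rfl⟩
  · ext y
    simp only [Language.mem_iSup, Language.mem_leftQuotient, Language.mem_mul]
    constructor
    · rintro ⟨c, ⟨⟨_, a, b, rfl, ha, rfl⟩, hc⟩, z, hz, rfl⟩
      obtain ⟨S, rfl, hS⟩ := ha
      obtain ⟨T, rfl, hT⟩ := hz
      refine ⟨S ++ [b ++ c] ++ T, by simp, ?_⟩
      intro w hw
      simp only [List.mem_append, List.mem_singleton] at hw
      rcases hw with (hw | rfl) | hw
      exacts [hS _ hw, hc, hT _ hw]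
    · rintro ⟨S, hS, hSL⟩
      have key : ∀ (S : List (List α)) (x : List α), x ≠ [] → x ++ y = S.flatten →
          (∀ w ∈ S, w ∈ L) → ∃ a b c z, a ++ b = x ∧ a ∈ L∗ ∧ b ++ c ∈ L ∧ z ∈ L∗ ∧ c ++ z = y := by
        intro S
        induction S with
        | nil => intro x hx h; simp at h; exact absurd h.1 hx
        | cons s S ih =>
          intro x hx h hS
          rw [List.flatten_cons] at h
          have hsL := hS s (by simp)
          have hSL : ∀ w ∈ S, w ∈ L := fun w hw => hS w (by simp [hw])
          rcases List.append_eq_append_iff.1 h with ⟨c, rfl, rfl⟩ | ⟨c, rfl, h2⟩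
          · exact ⟨[], x, c, S.flatten, by simp, Language.nil_mem_kstar L, hsL, ⟨S, rfl, hSL⟩, rfl⟩
          · by_cases hc : c = []
            · subst hc
              exact ⟨[], s, [], S.flatten, by simp, Language.nil_mem_kstar L, by simpa using hsL,
                ⟨S, rfl, hSL⟩, by simpa using h2⟩
            · obtain ⟨a, b, c', z, rfl, ⟨T, rfl, hT⟩, h3, h4, h5⟩ := ih c hc h2.symm hSL
              refine ⟨s ++ T.flatten, b, c', z, by simp, ⟨s :: T, by simp, ?_⟩, h3, h4, h5⟩
              intro w hw
              rcases List.mem_cons.1 hw with rfl | hw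
              exacts [hsL, hT _ hw]
      obtain ⟨a, b, c, z, h1, h2, h3, h4, h5⟩ := key S x hx hS hSL
      exact ⟨c, ⟨⟨_, a, b, h1, h2, rfl⟩, h3⟩, z, h4, h5⟩

theorem isRegular_of_finite (hL : Set.Finite (L : Set (List α))) : L.IsRegular := by
  rw [Language.isRegular_iff_finite_range_leftQuotient]
  have hs : (⋃ w ∈ (L : Set (List α)), {y : List α | y <:+ w}).Finite :=
    hL.biUnion fun w _ => (w.tails.finite_toSet).subset fun y hy => by simpa using hy
  refine hs.finite_subsets.subset ?_
  rintro _ ⟨x, rfl⟩ y hy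
  exact Set.mem_biUnion (x := x ++ y) hy ⟨x, rfl⟩

end Regular

/-! ### Counter programs -/

/-- Contents of countably many counters. -/
abbrev Counters := ℕ → ℕ

/-- Elementary operations on counters: increment, decrement of a nonzero counter, zero test. -/
inductive CounterOp
  | inc (r : ℕ)
  | dec (r : ℕ)
  | zero (r : ℕ)

open Function (update)

/-- The effect of an elementary operation. -/
def CounterOp.Step : CounterOp → Counters → Counters → Prop
  | inc r, v, v' => v' = update v r (v r + 1)
  | dec r, v, v' => v r ≠ 0 ∧ v' = update v r (v r - 1)
  | zero r, v, v' => v' = v ∧ v r = 0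

/-- The effect of a sequence of elementary operations. -/
def Exec : List CounterOp → Counters → Counters → Prop
  | [], v, v' => v' = v
  | a :: w, v, v' => ∃ u, a.Step v u ∧ Exec w u v'

theorem exec_append {w₁ w₂ : List CounterOp} {v v' : Counters} :
    Exec (w₁ ++ w₂) v v' ↔ ∃ u, Exec w₁ v u ∧ Exec w₂ u v' := by
  induction w₁ generalizing v with
  | nil => simp [Exec]
  | cons a w ih =>
    simp only [List.cons_append, Exec, ih]
    constructor
    · rintro ⟨u, hu, x, hx, hv⟩; exact ⟨x, ⟨u, hu, hx⟩, hv⟩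
    · rintro ⟨x, ⟨u, hu, hx⟩, hv⟩; exact ⟨u, hu, x, hx, hv⟩

/-- Structured counter programs. `loop r p` decrements `r` and runs `p` as long as `r` is not
zero. -/
inductive Prog
  | skip
  | inc (r : ℕ)
  | seq (p q : Prog)
  | loop (r : ℕ) (p : Prog)

namespace Prog

/-- Input-output semantics of programs. -/
inductive BigStep : Prog → Counters → Counters → Prop
  | skip (v) : BigStep skip v v
  | inc (r v) : BigStep (inc r) v (update v r (v r + 1))
  | seq {p q v u v'} : BigStep p v u → BigStep q u v' → BigStep (seq p q) v v'
  | loopZero {r p v} : v r = 0 → BigStep (loop r p) v v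
  | loopSucc {r p v u v'} : v r ≠ 0 → BigStep p (update v r (v r - 1)) u →
      BigStep (loop r p) u v' → BigStep (loop r p) v v'

open Computability in
/-- The language of the sequences of elementary operations that a program may perform. -/
def lang : Prog → Language CounterOp
  | skip => 1
  | inc r => {[CounterOp.inc r]}
  | seq p q => p.lang * q.lang
  | loop r p => ({[CounterOp.dec r]} * p.lang)∗ * {[CounterOp.zero r]}

theorem isRegular_lang (p : Prog) : p.lang.IsRegular := by
  induction p with
  | skip => exact isRegular_of_finite (Set.finite_singleton _)
  | inc r => exact isRegular_of_finite (Set.finite_singleton _)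
  | seq p q ihp ihq => exact isRegular_mul ihp ihq
  | loop r p ih =>
    exact isRegular_mul (isRegular_kstar (isRegular_mul
      (isRegular_of_finite (Set.finite_singleton _)) ih))
      (isRegular_of_finite (Set.finite_singleton _))

theorem exists_finite_ops (p : Prog) :
    ∃ S : Set CounterOp, S.Finite ∧ ∀ w ∈ p.lang, ∀ a ∈ w, a ∈ S := by
  induction p with
  | skip => exact ⟨∅, Set.finite_empty, by rintro w rfl; simp⟩
  | inc r => exact ⟨{.inc r}, Set.finite_singleton _, by rintro w rfl; simp⟩
  | seq p q ihp ihq =>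
    obtain ⟨S, hS, h⟩ := ihp
    obtain ⟨T, hT, h'⟩ := ihq
    refine ⟨S ∪ T, hS.union hT, ?_⟩
    rintro _ ⟨x, hx, y, hy, rfl⟩ a ha
    rcases List.mem_append.1 ha with ha | ha
    exacts [.inl (h x hx a ha), .inr (h' y hy a ha)]
  | loop r p ih =>
    obtain ⟨S, hS, h⟩ := ih
    refine ⟨S ∪ {.dec r, .zero r}, hS.union (by simp), ?_⟩
    rintro _ ⟨_, ⟨l, rfl, hl⟩, _, rfl, rfl⟩ a ha
    rcases List.mem_append.1 ha with ha | ha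
    · obtain ⟨x, hx, ha⟩ := List.mem_flatten.1 ha
      obtain ⟨_, rfl, y, hy, rfl⟩ := hl x hx
      rcases List.mem_append.1 ha with ha | ha
      · rw [List.mem_singleton.1 ha]; simp
      · exact .inl (h y hy a ha)
    · rw [List.mem_singleton.1 ha]; simp

theorem bigStep_iff_exec {p : Prog} {v v' : Counters} :
    BigStep p v v' ↔ ∃ w ∈ p.lang, Exec w v v' := by
  constructor
  · intro h
    induction h with
    | skip v => exact ⟨[], rfl, rfl⟩
    | inc r v => exact ⟨_, rfl, _, rfl, rfl⟩
    | seq _ _ ihp ihq =>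
      obtain ⟨x, hx, hx'⟩ := ihp
      obtain ⟨y, hy, hy'⟩ := ihq
      exact ⟨x ++ y, ⟨x, hx, y, hy, rfl⟩, exec_append.2 ⟨_, hx', hy'⟩⟩
    | @loopZero r p v h =>
      exact ⟨[.zero r], ⟨[], Language.nil_mem_kstar _, _, rfl, rfl⟩, v, ⟨rfl, h⟩, rfl⟩
    | @loopSucc r p v u v' h _ _ ihp ihl =>
      obtain ⟨x, hx, hx'⟩ := ihp
      obtain ⟨_, ⟨_, ⟨l, rfl, hl⟩, _, rfl, rfl⟩, hy'⟩ := ihl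
      refine ⟨(([.dec r] ++ x) :: l).flatten ++ [.zero r], ⟨_, ⟨_, rfl, ?_⟩, _, rfl, rfl⟩, ?_⟩
      · intro y hy
        rcases List.mem_cons.1 hy with rfl | hy
        exacts [⟨_, rfl, x, hx, rfl⟩, hl y hy]
      · rw [List.flatten_cons, List.append_assoc, List.append_assoc]
        exact ⟨_, ⟨h, rfl⟩, (exec_append (w₁ := x)).2 ⟨u, hx', hy'⟩⟩
  · rintro ⟨w, hw, h⟩
    induction p generalizing v v' w with
    | skip => obtain rfl := hw; obtain rfl := h; exact .skip _
    | inc r =>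
      obtain rfl := hw
      obtain ⟨u, h, h'⟩ := h
      obtain rfl := h'
      obtain rfl := h
      exact .inc r v
    | seq p q ihp ihq =>
      obtain ⟨x, hx, y, hy, rfl⟩ := hw
      obtain ⟨u, h, h'⟩ := exec_append.1 h
      exact .seq (ihp x hx h) (ihq y hy h')
    | loop r p ih =>
      obtain ⟨_, ⟨l, rfl, hl⟩, _, rfl, rfl⟩ := hw
      induction l generalizing v with
      | nil =>
        obtain ⟨u, ⟨rfl, h⟩, h'⟩ := h
        obtain rfl := h'
        exact .loopZero h
      | cons x l ihl =>
        obtain ⟨_, rfl, x, hx, rfl⟩ := hl _ (List.mem_cons_self ..)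
        simp only [List.flatten_cons, List.append_assoc, List.singleton_append] at h
        obtain ⟨u, ⟨h0, rfl⟩, h⟩ := h
        obtain ⟨u, h1, h2⟩ := exec_append.1 h
        exact .loopSucc h0 (ih x hx h1) (ihl (fun y hy => hl y (List.mem_cons_of_mem _ hy)) h2)

theorem bigStep_skip {v v' : Counters} : BigStep skip v v' ↔ v' = v :=
  ⟨fun h => by cases h; rfl, fun h => h ▸ .skip v⟩

theorem bigStep_inc {r : ℕ} {v v' : Counters} :
    BigStep (inc r) v v' ↔ v' = update v r (v r + 1) :=
  ⟨fun h => by cases h; rfl, fun h => h ▸ .inc r v⟩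

theorem bigStep_seq {p q : Prog} {v v' : Counters} :
    BigStep (seq p q) v v' ↔ ∃ u, BigStep p v u ∧ BigStep q u v' :=
  ⟨fun h => by cases h with | seq h h' => exact ⟨_, h, h'⟩, fun ⟨_, h, h'⟩ => .seq h h'⟩

theorem bigStep_loop {r : ℕ} {p : Prog} {v v' : Counters} :
    BigStep (loop r p) v v' ↔ v r = 0 ∧ v' = v ∨
      v r ≠ 0 ∧ ∃ u, BigStep p (update v r (v r - 1)) u ∧ BigStep (loop r p) u v' := by
  constructor
  · intro h
    cases h with
    | loopZero h => exact .inl ⟨h, rfl⟩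
    | loopSucc h h' h'' => exact .inr ⟨h, _, h', h''⟩
  · rintro (⟨h, rfl⟩ | ⟨h, u, hp, hl⟩)
    exacts [.loopZero h, .loopSucc h hp hl]

/-- A loop whose body acts deterministically on a family of states indexed by the loop counter. -/
theorem bigStep_loop_of_family {r : ℕ} {p : Prog} (s : ℕ → Counters) (hs : ∀ k, s k r = k) (A : ℕ)
    (h : ∀ k < A, ∀ v', BigStep p (update (s (k + 1)) r k) v' ↔ v' = s k) {v' : Counters} :
    BigStep (loop r p) (s A) v' ↔ v' = s 0 := by
  induction A with
  | zero => rw [bigStep_loop]; simp [hs]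
  | succ A ih =>
    rw [bigStep_loop, ← ih fun k hk => h k (hk.trans A.lt_succ_self)]
    simp [hs, h A A.lt_succ_self]

/-- Set a counter to zero. -/
def clear (a : ℕ) : Prog := loop a skip

theorem bigStep_clear {a : ℕ} {v v' : Counters} :
    BigStep (clear a) v v' ↔ v' = update v a 0 := by
  have := bigStep_loop_of_family (r := a) (p := skip) (v' := v') (fun k => update v a k) (by simp)
    (v a) (by simp [bigStep_skip])
  simpa [clear] using this

/-- Add counter `a` to counter `b`, with the help of a counter `t` that is initially zero. -/
def copy (a b t : ℕ) : Prog := seq (loop a (seq (inc b) (inc t))) (loop t (inc a))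

theorem bigStep_copy {a b t : ℕ} (hab : a ≠ b) (hat : a ≠ t) (hbt : b ≠ t) {v v' : Counters}
    (ht : v t = 0) : BigStep (copy a b t) v v' ↔ v' = update v b (v b + v a) := by
  have h1 := fun v' => bigStep_loop_of_family (r := a) (p := seq (inc b) (inc t)) (v' := v')
    (fun k => update (update (update v b (v b + (v a - k))) t (v a - k)) a k) (by simp)
    (v a) (by
      intro k hk v'
      simp only [bigStep_seq, bigStep_inc, exists_eq_left]
      refine iff_of_eq (congrArg _ ?_)
      funext x
      simp only [Function.update_apply]
      split_ifs <;> omega)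
  have h2 := bigStep_loop_of_family (r := t) (p := inc a) (v' := v')
    (fun k => update (update (update v b (v b + v a)) t k) a (v a - k)) (by simp [hat.symm])
    (v a) (by
      intro k hk v'
      simp only [bigStep_inc]
      refine iff_of_eq (congrArg _ ?_)
      funext x
      simp only [Function.update_apply]
      split_ifs <;> omega)
  have e1 : update (update (update v b (v b + (v a - v a))) t (v a - v a)) a (v a) = v := by
    funext x
    simp only [Function.update_apply]
    split_ifs <;> simp_all
  have e2 : update (update (update v b (v b + (v a - 0))) t (v a - 0)) a 0 =
      update (update (update v b (v b + v a)) t (v a)) a (v a - v a) := by simp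
  have e3 : update (update (update v b (v b + v a)) t 0) a (v a - 0) =
      update v b (v b + v a) := by
    funext x
    simp only [Function.update_apply]
    split_ifs <;> simp_all
  rw [e1] at h1
  rw [e3] at h2
  simp only [copy, bigStep_seq, h1, exists_eq_left, e2, h2]

end Prog

open Function (update)

/-! ### Counter programs for the schemes of partial recursion -/

namespace Prog

/-- A relation between tuples and numbers is programmable if, for all input counters `ins`, output
counter `o` and bound `b` on them, some program started with zero in `o` and in all counters from
`b` on adds the output to the counters and changes nothing else. -/
def Programmable {n : ℕ} (F : (Fin n → ℕ) → ℕ → Prop) : Prop :=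
  ∀ (ins : Fin n → ℕ) (o b : ℕ), (∀ i, ins i < b) → o < b → (∀ i, ins i ≠ o) →
    ∃ p : Prog, ∀ v : Counters, (∀ r, b ≤ r → v r = 0) → v o = 0 →
      ∀ v', BigStep p v v' ↔ ∃ y, F (v ∘ ins) y ∧ v' = update v o y

theorem Programmable.congr {n : ℕ} {F G : (Fin n → ℕ) → ℕ → Prop} (hF : Programmable F)
    (h : ∀ a y, F a y ↔ G a y) : Programmable G := by
  have : F = G := funext₂ fun a y => propext (h a y)
  exact this ▸ hF

theorem programmable_zero {n : ℕ} : Programmable fun (_ : Fin n → ℕ) y => y = 0 := by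
  intro ins o b _ _ _
  refine ⟨skip, fun v _ ho v' => ?_⟩
  simp [bigStep_skip, ← ho]

theorem programmable_get {n : ℕ} (i : Fin n) : Programmable fun a y => y = a i := by
  intro ins o b hins ho hne
  refine ⟨copy (ins i) o b, fun v hb ho' v' => ?_⟩
  rw [bigStep_copy (hne i) (hins i).ne ho.ne (hb b le_rfl)]
  simp [ho']

theorem programmable_succ {n : ℕ} (i : Fin n) : Programmable fun a y => y = a i + 1 := by
  intro ins o b hins ho hne
  refine ⟨seq (copy (ins i) o b) (inc o), fun v hb ho' v' => ?_⟩
  simp [bigStep_seq, bigStep_copy (hne i) (hins i).ne ho.ne (hb b le_rfl), bigStep_inc, ho']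

/-- The values go to `b, …, b + k - 1`. Each evaluation has its scratch area from `b + n` on, past
all the slots, so earlier results survive. -/
theorem exists_prog_tuple {n m : ℕ} {g : Fin n → (Fin m → ℕ) → ℕ → Prop}
    (hg : ∀ i, Programmable (g i)) (ins : Fin m → ℕ) (b : ℕ) (hins : ∀ i, ins i < b) (k : ℕ)
    (hk : k ≤ n) :
    ∃ p : Prog, ∀ v : Counters, (∀ r, b ≤ r → v r = 0) → ∀ v', BigStep p v v' ↔
      ∃ y : Fin n → ℕ, (∀ i : Fin n, i < k → g i (v ∘ ins) (y i)) ∧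
        v' = fun x => if h : b ≤ x ∧ x < b + k then y ⟨x - b, by omega⟩ else v x := by
  induction k with
  | zero =>
    refine ⟨skip, fun v _ v' => ?_⟩
    rw [bigStep_skip]
    constructor
    · rintro rfl
      exact ⟨fun _ => 0, by simp, by funext x; rw [dif_neg (by omega)]⟩
    · rintro ⟨y, -, rfl⟩
      funext x; rw [dif_neg (by omega)]
  | succ k ih =>
    obtain ⟨p, hp⟩ := ih (by omega)
    obtain ⟨q, hq⟩ := hg ⟨k, hk⟩ ins (b + k) (b + n) (fun i => by have := hins i; omega) (by omega)
      (fun i => by have := hins i; omega)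
    refine ⟨seq p q, fun v hb v' => ?_⟩
    have key : ∀ (y : Fin n → ℕ) (v' : Counters), BigStep q
        (fun x => if h : b ≤ x ∧ x < b + k then y ⟨x - b, by omega⟩ else v x) v' ↔
        ∃ z, g ⟨k, hk⟩ (v ∘ ins) z ∧ v' = fun x => if h : b ≤ x ∧ x < b + (k + 1) then
          update y ⟨k, hk⟩ z ⟨x - b, by omega⟩ else v x := by
      intro y v'
      rw [hq _ (fun r hr => by rw [dif_neg (by omega)]; exact hb r (by omega))
        (by rw [dif_neg (by omega)]; exact hb _ (by omega))]
      have e : (fun x => if h : b ≤ x ∧ x < b + k then y ⟨x - b, by omega⟩ else v x) ∘ ins =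
          v ∘ ins := by
        funext i
        have := hins i
        simp only [Function.comp]
        rw [dif_neg (by omega)]
      rw [e]
      refine exists_congr fun z => and_congr_right fun _ => iff_of_eq (congrArg _ ?_)
      funext x
      by_cases hx : x = b + k
      · subst hx
        rw [dif_pos (by omega)]
        simp
      · rw [Function.update_of_ne hx]
        by_cases hx' : b ≤ x ∧ x < b + k
        · rw [dif_pos hx', dif_pos (by omega), Function.update_of_ne]
          simp only [ne_eq, Fin.mk.injEq]
          omega
        · rw [dif_neg hx', dif_neg (by omega)]
    rw [bigStep_seq]
    constructor
    · rintro ⟨u, hu, h⟩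
      obtain ⟨y, hy, rfl⟩ := (hp v hb u).1 hu
      obtain ⟨z, hz, rfl⟩ := (key y v').1 h
      refine ⟨update y ⟨k, hk⟩ z, fun i hi => ?_, rfl⟩
      by_cases h : i = ⟨k, hk⟩
      · subst h; simpa using hz
      · rw [Function.update_of_ne h]
        have : (i : ℕ) ≠ k := fun h' => h (Fin.ext h')
        exact hy i (by omega)
    · rintro ⟨y, hy, rfl⟩
      refine ⟨_, (hp v hb _).2 ⟨y, fun i hi => hy i (by omega), rfl⟩, (key y _).2
        ⟨y ⟨k, hk⟩, hy _ (by simp), ?_⟩⟩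
      simp

theorem exists_prog_clear (b k : ℕ) : ∃ p : Prog, ∀ v v' : Counters, BigStep p v v' ↔
    v' = fun x => if b ≤ x ∧ x < b + k then 0 else v x := by
  induction k with
  | zero =>
    refine ⟨skip, fun v v' => ?_⟩
    rw [bigStep_skip]
    refine iff_of_eq (congrArg _ ?_)
    funext x; rw [if_neg (by omega)]
  | succ k ih =>
    obtain ⟨p, hp⟩ := ih
    refine ⟨seq p (clear (b + k)), fun v v' => ?_⟩
    simp only [bigStep_seq, hp, bigStep_clear, exists_eq_left]
    refine iff_of_eq (congrArg _ ?_)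
    funext x
    simp only [Function.update_apply]
    split_ifs <;> first | rfl | omega

theorem programmable_comp {n m : ℕ} {F : (Fin n → ℕ) → ℕ → Prop}
    {g : Fin n → (Fin m → ℕ) → ℕ → Prop} (hF : Programmable F) (hg : ∀ i, Programmable (g i)) :
    Programmable fun a y => ∃ u : Fin n → ℕ, (∀ i, g i a (u i)) ∧ F u y := by
  intro ins o b hins ho hne
  obtain ⟨p, hp⟩ := exists_prog_tuple hg ins b hins n le_rfl
  obtain ⟨q, hq⟩ := hF (fun i => b + i) o (b + n) (by simp) (by omega) (by omega)
  obtain ⟨c, hc⟩ := exists_prog_clear b n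
  refine ⟨seq p (seq q c), fun v hb ho' v' => ?_⟩
  have key : ∀ (u : Fin n → ℕ) (v' : Counters), BigStep (seq q c)
      (fun x => if h : b ≤ x ∧ x < b + n then u ⟨x - b, by omega⟩ else v x) v' ↔
      ∃ y, F u y ∧ v' = update v o y := by
    intro u v'
    have e : (fun x => if h : b ≤ x ∧ x < b + n then u ⟨x - b, by omega⟩ else v x) ∘
        (fun i : Fin n => b + (i : ℕ)) = u := by
      funext i
      simp
    have e' : ∀ y, (fun x => if b ≤ x ∧ x < b + n then 0 else
        update (fun x => if h : b ≤ x ∧ x < b + n then u ⟨x - b, by omega⟩ else v x) o y x) =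
        update v o y := by
      intro y
      funext x
      by_cases hx : b ≤ x ∧ x < b + n
      · rw [if_pos hx, Function.update_of_ne (by omega), hb x hx.1]
      · simp only [Function.update_apply, if_neg hx, dif_neg hx]
    have hq' := hq (fun x => if h : b ≤ x ∧ x < b + n then u ⟨x - b, by omega⟩ else v x)
      (fun r hr => by rw [dif_neg (by omega)]; exact hb r (by omega))
      (by rw [dif_neg (by omega)]; exact ho')
    rw [e] at hq'
    simp only [bigStep_seq, hc, hq']
    constructor
    · rintro ⟨_, ⟨y, hy, rfl⟩, rfl⟩
      exact ⟨y, hy, e' y⟩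
    · rintro ⟨y, hy, rfl⟩
      exact ⟨_, ⟨y, hy, rfl⟩, (e' y).symm⟩
  rw [bigStep_seq]
  constructor
  · rintro ⟨w, hw, h⟩
    obtain ⟨u, hu, rfl⟩ := (hp v hb w).1 hw
    obtain ⟨y, hy, rfl⟩ := (key u v').1 h
    exact ⟨y, ⟨u, fun i => hu i i.2, hy⟩, rfl⟩
  · rintro ⟨y, ⟨u, hu, hy⟩, rfl⟩
    exact ⟨_, (hp v hb _).2 ⟨u, fun i _ => hu i, rfl⟩, (key u _).2 ⟨y, hy, rfl⟩⟩

/-- The value at `k` of the function defined by primitive recursion from `f` and `g`. -/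
def precVal {n : ℕ} (f : (Fin n → ℕ) → ℕ) (g : (Fin (n + 2) → ℕ) → ℕ) (a : Fin n → ℕ) (k : ℕ) : ℕ :=
  k.rec (f a) fun y IH => g (Fin.cons y (Fin.cons IH a))

/-- Counter `b` counts the remaining rounds, `b + 1` holds the recursion argument, `b + 2` receives
the new value before it moves to `o`, and `b + 3` is scratch for `copy`. -/
theorem programmable_prec {n : ℕ} {f : (Fin n → ℕ) → ℕ} {g : (Fin (n + 2) → ℕ) → ℕ}
    (hf : Programmable fun a y => y = f a) (hg : Programmable fun a y => y = g a) :
    Programmable fun (a : Fin (n + 1) → ℕ) y => y = precVal f g (Fin.tail a) (a 0) := by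
  intro ins o b hins ho hne
  obtain ⟨p, hp⟩ := hf (Fin.tail ins) o b (fun i => hins _) ho (fun i => hne _)
  obtain ⟨q, hq⟩ := hg (Fin.cons (b + 1) (Fin.cons o (Fin.tail ins))) (b + 2) (b + 4)
    (by
      refine Fin.cases (by simp) (Fin.cases (by simp; omega) fun i => ?_)
      simpa [Fin.tail] using (hins i.succ).trans (by omega)) (by omega)
    (by
      refine Fin.cases (by simp) (Fin.cases (by simp; omega) fun i => ?_)
      simpa [Fin.tail] using ((hins i.succ).trans (by omega)).ne)
  refine ⟨seq p (seq (copy (ins 0) b (b + 3)) (seq (loop b (seq q (seq (clear o)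
    (seq (copy (b + 2) o (b + 3)) (seq (clear (b + 2)) (inc (b + 1))))))) (clear (b + 1)))),
    fun v hb ho' v' => ?_⟩
  set a := v ∘ ins with ha
  set R := precVal f g (Fin.tail a) with hR
  -- Loop invariant: with `k` rounds left, `a 0 - k` rounds are done and `o` holds the value at `a 0
  -- - k`.
  let s : ℕ → Counters := fun k => update (update (update v o (R (a 0 - k))) (b + 1) (a 0 - k)) b k
  have hins0 := hins 0
  have hne0 := hne 0
  have hloop := fun v' => bigStep_loop_of_family (r := b) (p := seq q (seq (clear o)
    (seq (copy (b + 2) o (b + 3)) (seq (clear (b + 2)) (inc (b + 1)))))) (v' := v') s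
    (by simp [s]) (a 0) (by
      intro k hk v'
      have e : (update (s (k + 1)) b k) ∘ (Fin.cons (b + 1) (Fin.cons o (Fin.tail ins)) :
          Fin (n + 2) → ℕ) = Fin.cons (a 0 - (k + 1)) (Fin.cons (R (a 0 - (k + 1)))
            (Fin.tail a)) := by
        funext i
        refine Fin.cases ?_ (Fin.cases ?_ fun i => ?_) i
        · simp [s]
        · simp only [s, Function.comp, Fin.cons_succ, Fin.cons_zero, Function.update_apply]
          split_ifs <;> first | rfl | omega
        · have h1 := hins i.succ
          have h2 := hne i.succ
          simp only [s, Function.comp, Fin.cons_succ, Function.update_apply, Fin.tail, ha]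
          split_ifs <;> first | rfl | omega
      have hRk : g (Fin.cons (a 0 - (k + 1)) (Fin.cons (R (a 0 - (k + 1))) (Fin.tail a))) =
          R (a 0 - k) := by
        have : a 0 - k = (a 0 - (k + 1)) + 1 := by omega
        rw [this]; rfl
      have hv : ∀ r, b < r → v r = 0 := fun r hr => hb r hr.le
      have hc : ∀ r, b + 2 ≤ r → update (s (k + 1)) b k r = 0 := by
        intro r hr
        simp only [s, Function.update_apply]
        split_ifs <;> first | omega | exact hv r (by omega)
      simp only [bigStep_seq, hq _ (fun r hr => hc r (by omega)) (hc _ le_rfl), e, hRk,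
        bigStep_clear, bigStep_inc, exists_eq_left]
      rw [show (∃ u, BigStep (copy (b + 2) o (b + 3))
        (update (update (update (s (k + 1)) b k) (b + 2) (R (a 0 - k))) o 0) u ∧
          v' = update (update u (b + 2) 0) (b + 1) (update u (b + 2) 0 (b + 1) + 1)) ↔ _ from
        exists_congr fun u => and_congr_left' (bigStep_copy (by omega) (by omega) (by omega) (by
          rw [Function.update_of_ne (by omega), Function.update_of_ne (by omega)]
          exact hc _ (by omega)))]
      rw [exists_eq_left]
      refine iff_of_eq (congrArg _ ?_)
      have h2 := hv (b + 2) (by omega)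
      funext x
      simp only [s, Function.update_apply]
      split_ifs <;> first | omega | simp_all)
  have e0 : update (update v o (f (Fin.tail a))) b (a 0) = s (a 0) := by
    have h1 := hb (b + 1) (by omega)
    have h2 : R 0 = f (Fin.tail a) := rfl
    funext x
    simp only [s, Function.update_apply]
    split_ifs <;> first | omega | simp_all
  have e1 : update (s 0) (b + 1) 0 = update v o (R (a 0)) := by
    have h1 := hb (b + 1) (by omega)
    have h2 := hb b le_rfl
    funext x
    simp only [s, Function.update_apply]
    split_ifs <;> simp_all
  have e2 : v ∘ Fin.tail ins = Fin.tail a := rfl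
  simp only [bigStep_seq, hp v hb ho', e2, exists_eq_left]
  rw [show (∃ u, BigStep (copy (ins 0) b (b + 3)) (update v o (f (Fin.tail a))) u ∧ _) ↔ _ from
    exists_congr fun u => and_congr_left' (bigStep_copy (by omega) (by omega) (by omega) (by
      rw [Function.update_of_ne (by omega)]
      exact hb _ (by omega)))]
  have e3 : update v o (f (Fin.tail a)) b + update v o (f (Fin.tail a)) (ins 0) = a 0 := by
    rw [Function.update_of_ne (by omega), Function.update_of_ne (by omega), hb b le_rfl, zero_add]
    rfl
  rw [exists_eq_left, e3, e0]
  simp only [hloop, bigStep_clear, exists_eq_left, e1, R]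

/-- Counter `b` holds the candidate and `b + 1` the value of `f` there. While this value is nonzero,
the loop discards it, increments the candidate and evaluates `f` again; it ends exactly when a zero
is found. -/
theorem programmable_rfind {n : ℕ} {f : (Fin (n + 1) → ℕ) → ℕ}
    (hf : Programmable fun a y => y = f a) :
    Programmable fun (a : Fin n → ℕ) y =>
      f (Fin.cons y a) = 0 ∧ ∀ j < y, f (Fin.cons j a) ≠ 0 := by
  intro ins o b hins ho hne
  obtain ⟨p, hp⟩ := hf (Fin.cons b ins) (b + 1) (b + 3)
    (by
      refine Fin.cases (by simp) fun i => ?_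
      simpa using (hins i).trans (by omega)) (by omega)
    (by
      refine Fin.cases (by simp) fun i => ?_
      simpa using ((hins i).trans (by omega)).ne)
  refine ⟨seq p (seq (loop (b + 1) (seq (clear (b + 1)) (seq (inc b) p)))
    (seq (copy b o (b + 2)) (clear b))), fun v hb ho' v' => ?_⟩
  set a := v ∘ ins with ha
  let h : ℕ → ℕ := fun j => f (Fin.cons j a)
  let s : ℕ → Counters := fun j => update (update v b j) (b + 1) (h j)
  have hrun : ∀ j v', BigStep p (update v b j) v' ↔ v' = s j := by
    intro j v'
    have e : update v b j ∘ (Fin.cons b ins : Fin (n + 1) → ℕ) = Fin.cons j a := by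
      funext i
      refine Fin.cases (by simp) (fun i => ?_) i
      have := hins i
      simp only [Function.comp, Fin.cons_succ, Function.update_apply, ha]
      split_ifs <;> first | rfl | omega
    rw [hp _ (fun r hr => by rw [Function.update_of_ne (by omega)]; exact hb r (by omega))
      (by rw [Function.update_of_ne (by omega)]; exact hb _ (by omega)), e]
    simp [s, h]
  have hbody : ∀ j v', BigStep (seq (clear (b + 1)) (seq (inc b) p))
      (update (s j) (b + 1) (s j (b + 1) - 1)) v' ↔ v' = s (j + 1) := by
    intro j v'
    have h1 := hb (b + 1) (by omega)
    simp only [bigStep_seq, bigStep_clear, bigStep_inc, exists_eq_left, ← hrun (j + 1)]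
    refine iff_of_eq (congrArg (fun u => BigStep p u v') ?_)
    funext x
    simp only [s, Function.update_apply]
    split_ifs <;> first | omega | (subst_vars; omega)
  have hsj : ∀ j, s j (b + 1) = h j := by simp [s]
  have hloop : ∀ j v', BigStep (loop (b + 1) (seq (clear (b + 1)) (seq (inc b) p))) (s j) v' ↔
      ∃ y, j ≤ y ∧ h y = 0 ∧ (∀ i, j ≤ i → i < y → h i ≠ 0) ∧ v' = s y := by
    intro j v'
    constructor
    -- The number of rounds is not known beforehand, so the induction is on the derivation.
    · intro H
      generalize hq : loop (b + 1) (seq (clear (b + 1)) (seq (inc b) p)) = q at H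
      generalize hu : s j = u at H
      induction H generalizing j with
      | skip => cases hq
      | inc => cases hq
      | seq => cases hq
      | loopZero h0 =>
        cases hq
        subst hu
        exact ⟨j, le_rfl, by rwa [hsj] at h0, by omega, rfl⟩
      | loopSucc h0 hb' _ _ ih =>
        cases hq
        subst hu
        obtain ⟨y, h1, h2, h3, h4⟩ := ih (j + 1) rfl ((hbody j _).1 hb').symm
        refine ⟨y, by omega, h2, fun i hi hiy => ?_, h4⟩
        rcases hi.eq_or_lt with rfl | hi
        · rwa [hsj] at h0
        · exact h3 i hi hiy
    · rintro ⟨y, h1, h2, h3, rfl⟩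
      obtain ⟨d, rfl⟩ := Nat.exists_eq_add_of_le h1
      clear h1
      induction d generalizing j with
      | zero => exact .loopZero (by rw [hsj]; exact h2)
      | succ d ih =>
        rw [show j + (d + 1) = j + 1 + d by omega] at *
        exact .loopSucc (by rw [hsj]; exact h3 j le_rfl (by omega)) ((hbody j _).2 rfl)
          (ih _ h2 fun i hi => h3 i (by omega))
  have hfin : ∀ y, h y = 0 → ∀ v', BigStep (seq (copy b o (b + 2)) (clear b)) (s y) v' ↔
      v' = update v o y := by
    intro y hy v'
    have h1 := hb (b + 1) (by omega)
    have h2 := hb b le_rfl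
    rw [bigStep_seq]
    rw [show (∃ u, BigStep (copy b o (b + 2)) (s y) u ∧ _) ↔ _ from
      exists_congr fun u => and_congr_left' (bigStep_copy (by omega) (by omega) (by omega) (by
        simp only [s]
        rw [Function.update_of_ne (by omega), Function.update_of_ne (by omega)]
        exact hb _ (by omega)))]
    rw [exists_eq_left, bigStep_clear]
    refine iff_of_eq (congrArg _ ?_)
    funext x
    simp only [s, Function.update_apply]
    split_ifs <;> first | omega | simp_all
  have e0 : update v b 0 = v := by rw [← hb b le_rfl, Function.update_eq_self]
  have hrun0 := hrun 0
  rw [e0] at hrun0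
  rw [bigStep_seq]
  simp only [hrun0, exists_eq_left]
  rw [bigStep_seq]
  constructor
  · rintro ⟨u, hu, hu'⟩
    obtain ⟨y, -, h2, h3, rfl⟩ := (hloop 0 u).1 hu
    exact ⟨y, ⟨h2, fun j hj => h3 j (Nat.zero_le j) hj⟩, (hfin y h2 v').1 hu'⟩
  · rintro ⟨y, ⟨h2, h3⟩, rfl⟩
    exact ⟨_, (hloop 0 _).2 ⟨y, Nat.zero_le y, h2, fun i _ => h3 i, rfl⟩, (hfin y h2 _).2 rfl⟩

end Prog

open Function (update)

/-! ### Partial recursive functions as counter programs -/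

namespace Prog

theorem mem_mOfFn {n : ℕ} {g : Fin n → Part ℕ} {y : List.Vector ℕ n} :
    y ∈ List.Vector.mOfFn g ↔ ∀ i, y.get i ∈ g i := by
  induction n with
  | zero => simp [List.Vector.mOfFn, y.eq_nil]
  | succ n ih =>
    simp only [List.Vector.mOfFn, Part.bind_eq_bind, Part.pure_eq_some, Part.mem_bind_iff, ih,
      Part.mem_some_iff]
    constructor
    · rintro ⟨a, ha, u, hu, rfl⟩
      exact Fin.cases (by simpa using ha) fun i => by simpa using hu i
    · intro h
      exact ⟨y.head, by simpa using h 0, y.tail, fun i => by simpa using h i.succ, by simp⟩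

theorem ofFn_cons {n : ℕ} (y : ℕ) (a : Fin n → ℕ) :
    List.Vector.ofFn (Fin.cons y a : Fin (n + 1) → ℕ) = y ::ᵥ List.Vector.ofFn a := by
  simp [List.Vector.ofFn]

theorem programmable_of_primrec {n : ℕ} {f : List.Vector ℕ n → ℕ} (hf : Nat.Primrec' f) :
    Programmable fun a y => y = f (List.Vector.ofFn a) := by
  induction hf with
  | zero => exact programmable_zero
  | succ => exact (programmable_succ 0).congr fun a y => by simp [List.Vector.ofFn]
  | get i => exact (programmable_get i).congr fun a y => by simp
  | comp g _ _ ihf ihg =>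
    refine (programmable_comp ihf ihg).congr fun a y => ?_
    constructor
    · rintro ⟨u, hu, rfl⟩
      rw [funext hu]
    · rintro rfl
      exact ⟨_, fun i => rfl, rfl⟩
  | @prec n f g _ _ ihf ihg =>
    refine (programmable_prec (f := fun a => f (List.Vector.ofFn a))
      (g := fun a => g (List.Vector.ofFn a)) ihf ihg).congr fun a y => ?_
    have h1 : (List.Vector.ofFn a).head = a 0 := by simp [List.Vector.ofFn]
    have h2 : (List.Vector.ofFn a).tail = List.Vector.ofFn (Fin.tail a) := by
      simp only [List.Vector.ofFn, List.Vector.tail_cons]; rfl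
    simp only [precVal, ofFn_cons, h1, h2]

theorem programmable_of_partrec {n : ℕ} {f : List.Vector ℕ n →. ℕ} (hf : Nat.Partrec' f) :
    Programmable fun a y => y ∈ f (List.Vector.ofFn a) := by
  induction hf with
  | prim hf => exact (programmable_of_primrec hf).congr fun a y => by simp
  | @comp m n f g _ _ ihf ihg =>
    refine (programmable_comp ihf ihg).congr fun a y => ?_
    refine Iff.trans ?_ Part.mem_bind_iff.symm
    constructor
    · rintro ⟨u, hu, hy⟩
      exact ⟨List.Vector.ofFn u, mem_mOfFn.2 fun i => (List.Vector.get_ofFn u i).symm ▸ hu i, hy⟩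
    · rintro ⟨u, hu, hy⟩
      exact ⟨u.get, mem_mOfFn.1 hu, (List.Vector.ofFn_get u).symm ▸ hy⟩
  | @rfind n f _ ih =>
    refine (programmable_rfind (f := fun a => f (List.Vector.ofFn a))
      (ih.congr fun a y => by simp)).congr fun a y => ?_
    refine Iff.trans ?_ Nat.mem_rfind.symm
    simp only [ofFn_cons, Part.mem_some_iff, eq_comm (a := true), eq_comm (a := false),
      decide_eq_true_eq, decide_eq_false_iff_not, ne_eq]

/-- Every partial recursive function is computed by a counter program. -/
theorem exists_prog_of_partrec {f : ℕ →. ℕ} (hf : Partrec f) :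
    ∃ p : Prog, ∀ n, (∃ v', BigStep p (update 0 0 n) v') ↔ (f n).Dom := by
  obtain ⟨p, hp⟩ := programmable_of_partrec (Nat.Partrec'.part_iff₁.2 hf) (fun _ => 0) 1 2
    (by simp) (by simp) (by simp)
  refine ⟨p, fun n => ?_⟩
  have := hp (update 0 0 n)
    (fun r hr => by rw [Function.update_of_ne (by omega)]; rfl) (by simp)
  simp only [this]
  simp [List.Vector.ofFn, Part.dom_iff_mem]

end Prog

/-! ### Counter machines -/

/-- A counter machine, given as a graph whose nodes carry elementary operations or, with `none`,
the instruction to halt. The node `init`, which increments counter `0`, serves to load the input. -/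
structure CounterGraph (Λ : Type) where
  instr : Λ → Option CounterOp
  next : Λ → Λ → Prop
  start : Λ → Prop
  init : Λ
  instr_init : instr init = some (.inc 0)
  next_init : ∀ l, next init l
  not_next_self : ∀ l r, instr l = some (.dec r) → ¬ next l l

namespace CounterGraph

variable {Λ : Type}

/-- The machine may halt when it is at node `l` with counters `v`. -/
inductive HaltsFrom (G : CounterGraph Λ) : Λ → Counters → Prop
  | halt {l v} : G.instr l = none → HaltsFrom G l v
  | step {l a v v' l'} : G.instr l = some a → a.Step v v' → G.next l l' → HaltsFrom G l' v' →
      HaltsFrom G l v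

/-- The machine may halt on input `n`. -/
def Halts (G : CounterGraph Λ) (n : ℕ) : Prop := ∃ l, G.start l ∧ G.HaltsFrom l (update 0 0 n)

variable {σ : Type} {S : Set CounterOp}

/-- The node `l` of the graph of an automaton may be visited in state `s`. -/
def At (M : DFA CounterOp σ) (s : σ) : Option (Option (σ × S × Bool)) → Prop
  -- The node `none` is `init`: it serves the input only and is never part of a run of the
  -- automaton.
  | none => False
  | some none => s ∈ M.accept
  | some (some (t, _, _)) => t = s

/-- The counter machine that performs the sequences of operations accepted by an automaton. -/
def ofDFA (M : DFA CounterOp σ) (S : Set CounterOp) :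
    CounterGraph (Option (Option (σ × S × Bool))) where
  instr
    | none => some (.inc 0)
    | some none => none
    | some (some (_, a, _)) => some a
  next l l' := match l with
    | none => True
    | some none => False
    -- The bit is a dummy: if `a` is performed twice in state `s`, the run passes to the copy with
    -- the other bit, so no node need follow itself.
    | some (some (s, a, b)) => At M (M.step s a) l' ∧ l' ≠ some (some (s, a, b))
  start := At M M.start
  init := none
  instr_init := rfl
  next_init _ := trivial
  not_next_self l r h := by
    rcases l with _ | _ | ⟨s, a, b⟩
    · cases h
    · exact id
    · exact fun h => h.2 rfl

theorem exists_accepted_of_haltsFrom {M : DFA CounterOp σ} {l : Option (Option (σ × S × Bool))}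
    {v : Counters} (h : (ofDFA M S).HaltsFrom l v) {s : σ} (hs : At M s l) :
    ∃ w v', M.evalFrom s w ∈ M.accept ∧ Exec w v v' := by
  induction h generalizing s with
  | @halt l v h =>
    rcases l with _ | _ | ⟨s, a, b⟩
    · exact hs.elim
    · exact ⟨[], v, hs, rfl⟩
    · cases h
  | @step l a v v' l' h h' hn _ ih =>
    rcases l with _ | _ | ⟨s, a, b⟩
    · exact hs.elim
    · cases h
    · cases h
      obtain rfl := hs
      obtain ⟨w, u, hw, hu⟩ := ih hn.1
      exact ⟨a :: w, u, hw, _, h', hu⟩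

/-- Here `x` is the node just left; the first node of the run avoids it by taking the opposite bit.
-/
theorem haltsFrom_of_accepted {M : DFA CounterOp σ} {w : List CounterOp} (hS : ∀ a ∈ w, a ∈ S)
    {s : σ} (hw : M.evalFrom s w ∈ M.accept) {v v' : Counters} (h : Exec w v v')
    (x : σ × S × Bool) :
    ∃ l, At M s l ∧ l ≠ some (some x) ∧ (ofDFA M S).HaltsFrom l v := by
  induction w generalizing s v x with
  | nil => exact ⟨some none, hw, by simp, .halt rfl⟩
  | cons a w ih =>
    obtain ⟨u, h0, h⟩ := h
    let y : σ × S × Bool := (s, ⟨a, hS a (by simp)⟩, !x.2.2)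
    obtain ⟨l, h1, h2, h3⟩ := ih (fun b hb => hS b (by simp [hb])) (s := M.step s a) hw h y
    refine ⟨some (some y), rfl, ?_, .step rfl h0 ⟨h1, h2⟩ h3⟩
    intro h
    have := congrArg (fun z => z.2.2) (Option.some.inj (Option.some.inj h))
    simp [y] at this

theorem halts_ofDFA_iff {M : DFA CounterOp σ} (hS : ∀ w ∈ M.accepts, ∀ a ∈ w, a ∈ S) {n : ℕ} :
    (ofDFA M S).Halts n ↔ ∃ w ∈ M.accepts, ∃ v', Exec w (update 0 0 n) v' := by
  constructor
  · rintro ⟨l, hl, h⟩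
    obtain ⟨w, v', hw, h⟩ := exists_accepted_of_haltsFrom h hl
    exact ⟨w, hw, v', h⟩
  · rintro ⟨w, hw, v', h⟩
    cases w with
    | nil => exact ⟨some none, hw, .halt rfl⟩
    | cons a w =>
      obtain ⟨l, h1, -, h3⟩ := haltsFrom_of_accepted (hS _ hw) hw h
        (M.start, ⟨a, hS _ hw a (by simp)⟩, true)
      exact ⟨l, h1, h3⟩

/-- The halting problem of some counter machine is undecidable. -/
theorem exists_not_computablePred_halts :
    ∃ (Λ : Type) (_ : Fintype Λ) (G : CounterGraph Λ), ¬ ComputablePred G.Halts := by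
  -- A universal function, so that one machine suffices and the instance is carried by the input.
  let f : ℕ →. ℕ := fun n => (Denumerable.ofNat Nat.Partrec.Code n).eval 0
  have hf : Partrec f :=
    Nat.Partrec.Code.eval_part.comp (Computable.ofNat _) (Computable.const 0)
  obtain ⟨p, hp⟩ := Prog.exists_prog_of_partrec hf
  obtain ⟨σ, hσ, M, hM⟩ := p.isRegular_lang
  obtain ⟨S, hSf, hS⟩ := p.exists_finite_ops
  have := hSf.fintype
  refine ⟨_, inferInstance, ofDFA M S, fun hc => ComputablePred.halting_problem 0 ?_⟩
  refine ComputablePred.computable_of_manyOneReducible (q := (ofDFA M S).Halts) ?_ hc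
  refine ⟨Encodable.encode, Computable.encode, fun c => ?_⟩
  rw [halts_ofDFA_iff (by rwa [hM]), hM]
  have := hp (Encodable.encode c)
  simp only [f, Denumerable.ofNat_encode, Prog.bigStep_iff_exec] at this
  refine this.symm.trans ?_
  exact ⟨fun ⟨v, w, hw, h⟩ => ⟨w, hw, v, h⟩, fun ⟨w, hw, v, h⟩ => ⟨v, w, hw, h⟩⟩

end CounterGraph

/-! ### The formulas describing runs of a counter machine -/

/-- The letters of the data words that describe runs of a counter machine with nodes `Λ`.
A visit of a node `l` is announced by `visit l` with a fresh datum. This datum occurs again with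
the letter `link` once the following visit has been announced. A visit of a decrementing node `l`
contains `cancel l` with the datum of the visit of an incrementing node, and this datum occurs again with
the letter `mark` once the following visit has been announced. -/
inductive RunLetter (Λ : Type) : Type
  | visit (l : Λ)
  | link
  | mark
  | cancel (l : Λ)

namespace RunLetter

variable {Λ : Type}

instance [Finite Λ] : Finite (RunLetter Λ) :=
  Finite.of_surjective (fun x : Option (Option (Λ ⊕ Λ)) => match x with
    | none => link
    | some none => mark
    | some (some (.inl l)) => visit l
    | some (some (.inr l)) => cancel l) fun s => match s with
    | link => ⟨none, rfl⟩
    | mark => ⟨some none, rfl⟩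
    | visit l => ⟨some (some (.inl l)), rfl⟩
    | cancel l => ⟨some (some (.inr l)), rfl⟩

noncomputable instance [Finite Λ] : Fintype (RunLetter Λ) := Fintype.ofFinite _

def IsVisit (s : RunLetter Λ) : Prop := ∃ l, s = visit l

def IsCancel (s : RunLetter Λ) : Prop := ∃ l, s = cancel l

variable (Λ) in
/-- The number of letters. -/
noncomputable def num [Finite Λ] : ℕ := Fintype.card (RunLetter Λ)

/-- The numbering of the letters. -/
noncomputable def equiv [Finite Λ] : RunLetter Λ ≃ Fin (num Λ) := Fintype.equivFin _

end RunLetter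

/-- The letter at a position. -/
noncomputable def DataWord.sym {Λ : Type} [Finite Λ] {D : Type*} (w : DataWord (RunLetter.num Λ) D)
    (i : Fin w.len) : RunLetter Λ := RunLetter.equiv.symm (w.letter i)

namespace Formula

variable {op : DataQuantifier} {Λ : Type} {D : Type*}

/-- The disjunction of a list of formulas. -/
def disj : List (Formula op) → Formula op
  | [] => and test notTest
  | φ :: l => or φ (disj l)

/-- The conjunction of a list of formulas. -/
def conj : List (Formula op) → Formula op
  | [] => or test notTest
  | φ :: l => and φ (conj l)

section

variable {n : ℕ} {w : DataWord n D} {i : Fin w.len} {d : D}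

theorem holds_disj {l : List (Formula op)} :
    (disj l).Holds w i d ↔ ∃ φ ∈ l, φ.Holds w i d := by
  induction l with
  | nil => simp [disj, Holds]
  | cons φ l ih => simp [disj, Holds, ih]

theorem holds_conj {l : List (Formula op)} :
    (conj l).Holds w i d ↔ ∀ φ ∈ l, φ.Holds w i d := by
  induction l with
  | nil => simp [conj, Holds, em]
  | cons φ l ih => simp [conj, Holds, ih]

theorem overAlphabet_disj {l : List (Formula op)} (h : ∀ φ ∈ l, φ.OverAlphabet n) :
    (disj l).OverAlphabet n := by
  induction l with
  | nil => simp [disj, OverAlphabet]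
  | cons φ l ih => exact ⟨h φ (by simp), ih fun ψ hψ => h ψ (by simp [hψ])⟩

theorem overAlphabet_conj {l : List (Formula op)} (h : ∀ φ ∈ l, φ.OverAlphabet n) :
    (conj l).OverAlphabet n := by
  induction l with
  | nil => simp [conj, OverAlphabet]
  | cons φ l ih => exact ⟨h φ (by simp), ih fun ψ hψ => h ψ (by simp [hψ])⟩

end

variable [Fintype Λ]

open Classical in
/-- The letter at the current position satisfies `P`. -/
noncomputable def sym (P : RunLetter Λ → Prop) : Formula op :=
  disj ((Finset.univ.filter P).toList.map fun s => letter (RunLetter.equiv s))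

/-- If the letter at the current position satisfies `P`, then `φ` holds. -/
noncomputable def imp (P : RunLetter Λ → Prop) (φ : Formula op) : Formula op := or (sym fun s => ¬ P s) φ

/-- Wherever the letter satisfies `P`, the formula `φ` holds for the current datum. -/
noncomputable def onSym (P : RunLetter Λ → Prop) (φ : Formula op) : Formula op :=
  globally (imp P (freeze φ))

/-- The conjunction of a finite family of formulas. -/
noncomputable def all (f : Λ → Formula op) : Formula op := conj (Finset.univ.toList.map f)

variable {w : DataWord (RunLetter.num Λ) D} {i : Fin w.len} {d : D}

theorem holds_sym {P : RunLetter Λ → Prop} : (sym P : Formula op).Holds w i d ↔ P (w.sym i) := by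
  simp only [sym, holds_disj, List.mem_map, Finset.mem_toList, Finset.mem_filter,
    Finset.mem_univ, true_and]
  constructor
  · rintro ⟨_, ⟨s, hs, rfl⟩, h⟩
    have : w.letter i = RunLetter.equiv s := Fin.ext h
    simpa [DataWord.sym, this] using hs
  · intro h
    exact ⟨_, ⟨_, h, rfl⟩, by simp [Holds, DataWord.sym]⟩

theorem holds_imp {P : RunLetter Λ → Prop} {φ : Formula op} :
    (imp P φ).Holds w i d ↔ (P (w.sym i) → φ.Holds w i d) := by
  simp only [imp, Holds, holds_sym, imp_iff_not_or]

theorem holds_onSym {P : RunLetter Λ → Prop} {φ : Formula op} :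
    (onSym P φ).Holds w w.first d ↔ ∀ i, P (w.sym i) → φ.Holds w i (w.datum i) := by
  simp only [onSym, Holds, holds_imp]
  exact ⟨fun h i => h i (Nat.zero_le _), fun h i _ => h i⟩

theorem holds_all {f : Λ → Formula op} : (all f).Holds w i d ↔ ∀ l, (f l).Holds w i d := by
  simp [all, holds_conj]

theorem overAlphabet_sym (P : RunLetter Λ → Prop) :
    (sym P : Formula op).OverAlphabet (RunLetter.num Λ) := by
  refine overAlphabet_disj fun φ hφ => ?_
  obtain ⟨s, -, rfl⟩ := List.mem_map.1 hφ
  exact (RunLetter.equiv s).2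

theorem overAlphabet_imp {P : RunLetter Λ → Prop} {φ : Formula op} :
    (imp P φ).OverAlphabet (RunLetter.num Λ) ↔ φ.OverAlphabet (RunLetter.num Λ) :=
  and_iff_right (overAlphabet_sym _)

theorem overAlphabet_onSym {P : RunLetter Λ → Prop} {φ : Formula op} :
    (onSym P φ).OverAlphabet (RunLetter.num Λ) ↔ φ.OverAlphabet (RunLetter.num Λ) :=
  overAlphabet_imp (φ := freeze φ)

theorem overAlphabet_all {f : Λ → Formula op} (h : ∀ l, (f l).OverAlphabet (RunLetter.num Λ)) :
    (all f).OverAlphabet (RunLetter.num Λ) := by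
  refine overAlphabet_conj fun φ hφ => ?_
  obtain ⟨l, -, rfl⟩ := List.mem_map.1 hφ
  exact h l

end Formula

namespace CounterGraph

open Formula RunLetter

variable {Λ : Type} (G : CounterGraph Λ)

def IsDec (l : Λ) : Prop := ∃ r, G.instr l = some (.dec r)

/-- `s` announces the visit of a node testing the counter that is incremented at `l`. -/
def Tests (l : Λ) (s : RunLetter Λ) : Prop :=
  ∃ l' r, s = visit l' ∧ G.instr l = some (.inc r) ∧ G.instr l' = some (.zero r)

/-- `s` cancels an increment of the counter that is incremented at `l`. -/
def Cancels (l : Λ) (s : RunLetter Λ) : Prop :=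
  ∃ l' r, s = cancel l' ∧ G.instr l = some (.inc r) ∧ G.instr l' = some (.dec r)

variable [Fintype Λ] {op : DataQuantifier} {D : Type*}

/-- The register content occurs later with the letter `link`. -/
noncomputable def linkAhead : Formula op := future (and (sym (Λ := Λ) (· = link)) test)

/-- The register content does not occur later with the letter `link`. -/
noncomputable def noLinkAhead : Formula op := globally (imp (Λ := Λ) (· = link) notTest)

/-- A visit with a datum other than the register content is announced before a later occurrence
of the register content with the letter `link`. -/
noncomputable def visitAhead : Formula op :=
  future (and (sym (Λ := Λ) IsVisit) (and notTest (linkAhead (Λ := Λ))))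

/-- The conditions on the data word that only look ahead. -/
noncomputable def core : Formula op := conj [
  onSym (fun s : RunLetter Λ => ∃ l, s = visit l ∧ G.instr l ≠ none) (visitAhead (Λ := Λ)),
  all fun l : Λ => onSym (· = visit l) (globally (imp (fun s => ∃ l', s = visit l' ∧ ¬ G.next l l')
    (or test (noLinkAhead (Λ := Λ))))),
  all fun l : Λ => onSym (· = visit l) (globally (or (and (sym (· = visit l)) test)
    (globally (imp (Λ := Λ) IsVisit notTest)))),
  all fun l : Λ => onSym (fun s => s = visit l ∧ G.IsDec l)
    (future (and (sym (· = cancel l)) (visitAhead (Λ := Λ)))),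
  all fun l : Λ => onSym (· = visit l) (globally
    (imp (fun s => ∃ l', s = cancel l' ∧ ¬ (l' = l ∧ G.IsDec l))
      (globally (imp (Λ := Λ) IsVisit (or test (noLinkAhead (Λ := Λ))))))),
  onSym (Λ := Λ) IsCancel (future (and (sym (Λ := Λ) IsVisit)
    (future (and (sym (Λ := Λ) (· = mark)) test)))),
  onSym (Λ := Λ) IsCancel (globally (imp (Λ := Λ) IsCancel
    (or test (globally (imp (Λ := Λ) (· = mark) notTest))))),
  onSym (Λ := Λ) IsCancel (globally (imp (Λ := Λ) IsVisit
    (globally (imp (Λ := Λ) IsCancel notTest)))),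
  all fun l : Λ => onSym (· = visit l) (or (globally (sym fun s => ¬ G.Tests l s))
    (future (and (sym (G.Cancels l)) test))),
  all fun l : Λ => onSym (· = visit l) (globally (imp (G.Tests l)
    (globally (imp (G.Cancels l) notTest)))),
  onSym (fun s => ∃ l, s = visit l ∧ G.instr l = none) (globally (imp (Λ := Λ) IsVisit test))]

/-- Every letter `cancel` cancels an earlier increment. -/
noncomputable def backward : (op : DataQuantifier) → Formula op
  -- Every datum first occurs at a visit, and a visit whose datum is cancelled later must be an
  -- increment matching the cancellation.
  | .existsPast => and (globally (or (sym (Λ := Λ) IsVisit) (quant test)))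
      (all fun l : Λ => onSym (· = visit l)
        (globally (imp (fun s => IsCancel s ∧ ¬ G.Cancels l s) notTest)))
  -- At the first position the quantifier reaches every datum of the word: one that occurs under
  -- `cancel l` also occurs at a matching increment. The second conjunct excludes that this visit
  -- comes after the cancellation.
  | .forallFuture => and
      (all fun l => quant (or (globally (imp (· = cancel l) notTest))
        (future (and (sym fun s => ∃ l', s = visit l' ∧ G.Cancels l' (cancel l)) test))))
      (onSym (Λ := Λ) IsCancel (globally (imp (Λ := Λ) IsVisit notTest)))

/-- The node `init` is visited `n` times, and then a start node. -/
noncomputable def input : ℕ → Formula op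
  | 0 => sym fun s => ∃ l, s = visit l ∧ G.start l
  | n + 1 => and (sym (· = visit G.init)) (freeze (globally (imp (Λ := Λ) IsVisit
      (or test (or (noLinkAhead (Λ := Λ)) (input n))))))

/-- The formula that is satisfied by the data words describing halting runs on input `n`. -/
noncomputable def formula (n : ℕ) : Formula op :=
  .and (.and G.core (G.backward op)) (G.input n)

/-- The meaning of `CounterGraph.core`. -/
structure Describes (w : DataWord (RunLetter.num Λ) D) : Prop where
  exists_visit : ∀ i, (∃ l, w.sym i = visit l ∧ G.instr l ≠ none) → ∃ j, i ≤ j ∧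
    IsVisit (w.sym j) ∧ w.datum i ≠ w.datum j ∧ ∃ k, j ≤ k ∧ w.sym k = link ∧ w.datum i = w.datum k
  next : ∀ l i, w.sym i = visit l → ∀ j, i ≤ j → (∃ l', w.sym j = visit l' ∧ ¬ G.next l l') →
    w.datum i = w.datum j ∨ ∀ k, j ≤ k → w.sym k = link → w.datum i ≠ w.datum k
  -- `G` includes the current position, so instead of excluding repetitions this confines visits
  -- with the same datum to an uninterrupted block of copies.
  fresh : ∀ l i, w.sym i = visit l → ∀ j, i ≤ j → (w.sym j = visit l ∧ w.datum i = w.datum j) ∨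
    ∀ k, j ≤ k → IsVisit (w.sym k) → w.datum i ≠ w.datum k
  -- Some later visit after `c` still has the `link` of `i` ahead. That `c` even precedes the next
  -- visit is shown in `Follows.exists_cancel`.
  exists_cancel : ∀ l i, w.sym i = visit l ∧ G.IsDec l → ∃ c, i ≤ c ∧ w.sym c = cancel l ∧
    ∃ j, c ≤ j ∧ IsVisit (w.sym j) ∧ w.datum i ≠ w.datum j ∧
      ∃ k, j ≤ k ∧ w.sym k = link ∧ w.datum i = w.datum k
  -- Hence a cancellation between a visit and its successor belongs to that visit.
  cancel_of_dec : ∀ l i, w.sym i = visit l → ∀ c, i ≤ c →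
    (∃ l', w.sym c = cancel l' ∧ ¬ (l' = l ∧ G.IsDec l)) → ∀ j, c ≤ j → IsVisit (w.sym j) →
      w.datum i = w.datum j ∨ ∀ k, j ≤ k → w.sym k = link → w.datum i ≠ w.datum k
  -- `mark` is to cancellations what `link` is to visits: the datum is marked after a later visit,
  -- and by `mark_le` no cancellation of another datum comes in between.
  exists_mark : ∀ c, IsCancel (w.sym c) → ∃ j, c ≤ j ∧ IsVisit (w.sym j) ∧
    ∃ k, j ≤ k ∧ w.sym k = mark ∧ w.datum c = w.datum k
  mark_le : ∀ c, IsCancel (w.sym c) → ∀ c', c ≤ c' → IsCancel (w.sym c') →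
    w.datum c = w.datum c' ∨ ∀ k, c' ≤ k → w.sym k = mark → w.datum c ≠ w.datum k
  cancel_once : ∀ c, IsCancel (w.sym c) → ∀ j, c ≤ j → IsVisit (w.sym j) → ∀ c', j ≤ c' →
    IsCancel (w.sym c') → w.datum c ≠ w.datum c'
  cancel_of_test : ∀ l i, w.sym i = visit l → (∀ j, i ≤ j → ¬ G.Tests l (w.sym j)) ∨
    ∃ c, i ≤ c ∧ G.Cancels l (w.sym c) ∧ w.datum i = w.datum c
  cancel_le_test : ∀ l i, w.sym i = visit l → ∀ j, i ≤ j → G.Tests l (w.sym j) → ∀ c, j ≤ c →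
    G.Cancels l (w.sym c) → w.datum i ≠ w.datum c
  last : ∀ i, (∃ l, w.sym i = visit l ∧ G.instr l = none) → ∀ j, i ≤ j → IsVisit (w.sym j) →
    w.datum i = w.datum j

/-- Every letter `cancel` cancels an earlier increment. -/
def Backed (w : DataWord (RunLetter.num Λ) D) : Prop :=
  ∀ c l, w.sym c = cancel l → ∃ i, i < c ∧ ∃ l', w.sym i = visit l' ∧ G.Cancels l' (cancel l) ∧
    w.datum i = w.datum c

variable {G} {w : DataWord (RunLetter.num Λ) D} {d : D}

theorem holds_core_iff : (G.core : Formula op).Holds w w.first d ↔ G.Describes w := by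
  simp only [core, conj, holds_onSym, holds_all, Holds, holds_sym, holds_imp, visitAhead, linkAhead,
    noLinkAhead]
  exact ⟨fun ⟨h1, h2, h3, h4, h5, h6, h7, h8, h9, h10, h11, _⟩ =>
    ⟨h1, h2, h3, h4, h5, h6, h7, h8, h9, h10, h11⟩, fun ⟨h1, h2, h3, h4, h5, h6, h7, h8, h9, h10,
      h11⟩ => ⟨h1, h2, h3, h4, h5, h6, h7, h8, h9, h10, h11, em _⟩⟩

theorem holds_input_zero {i : Fin w.len} :
    (G.input 0 : Formula op).Holds w i d ↔ ∃ l, w.sym i = visit l ∧ G.start l := by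
  simp only [input, holds_sym]

theorem holds_input_succ {n : ℕ} {i : Fin w.len} :
    (G.input (n + 1) : Formula op).Holds w i d ↔ w.sym i = visit G.init ∧ ∀ j, i ≤ j →
      IsVisit (w.sym j) → w.datum i = w.datum j ∨
        (∀ k, j ≤ k → w.sym k = link → w.datum i ≠ w.datum k) ∨
          (G.input n : Formula op).Holds w j (w.datum i) := by
  simp only [input, Holds, holds_sym, holds_imp, noLinkAhead]

theorem backed_of_holds (h : (G.backward op).Holds w w.first d) : G.Backed w := by
  cases op with
  | existsPast =>
    simp only [backward, Holds, holds_all, holds_onSym, holds_imp, holds_sym,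
      DataQuantifier.Ranges] at h
    intro c l hc
    -- The first occurrence of the datum of `c` has none before it, so the formula makes it a visit.
    obtain ⟨i, hi, hmin⟩ := WellFounded.has_min wellFounded_lt {i | w.datum i = w.datum c} ⟨c, rfl⟩
    have hic : i ≤ c := not_lt.1 (hmin c rfl)
    rcases h.1 i (Nat.zero_le _) with ⟨l', hl'⟩ | ⟨j, hji, hj⟩
    · have hlt : i < c := hic.lt_of_ne (by rintro rfl; rw [hl'] at hc; cases hc)
      refine ⟨i, hlt, l', hl', ?_, hi⟩
      by_contra hn
      exact h.2 l' i hl' c hic ⟨⟨l, hc⟩, by rwa [hc]⟩ hi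
    · exact absurd hji (hmin j (hj.trans hi))
  | forallFuture =>
    simp only [backward, Holds, holds_all, holds_onSym, holds_imp, holds_sym,
      DataQuantifier.Ranges] at h
    intro c l hc
    rcases h.1 l c (Nat.zero_le _) with h1 | ⟨i, -, ⟨l', hl', h2⟩, h3⟩
    · exact absurd rfl (h1 c (Nat.zero_le _) hc)
    · refine ⟨i, ?_, l', hl', h2, h3.symm⟩
      by_contra hlt
      have hi : IsVisit (w.sym i) := ⟨l', hl'⟩
      exact h.2 c ⟨l, hc⟩ i (not_lt.1 hlt) hi h3

/-- A sufficient condition for `CounterGraph.backward`: a datum occurs for the first time when a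
visit is announced, and no visit is announced with a cancelled datum. -/
theorem holds_backward (hB : G.Backed w)
    (hfirst : ∀ i, ¬ IsVisit (w.sym i) → ∃ j, j < i ∧ w.datum j = w.datum i)
    (huniq : ∀ i j, IsVisit (w.sym i) → IsVisit (w.sym j) → w.datum i = w.datum j → i = j) :
    (G.backward op).Holds w w.first d := by
  cases op with
  | existsPast =>
    simp only [backward, Holds, holds_all, holds_onSym, holds_imp, holds_sym,
      DataQuantifier.Ranges]
    refine ⟨fun i _ => or_iff_not_imp_left.2 (hfirst i), ?_⟩
    rintro l i hi c hic ⟨⟨l', hl'⟩, hn⟩ hd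
    obtain ⟨j, hj, l'', h1, h2, h3⟩ := hB c l' hl'
    obtain rfl := huniq i j ⟨l, hi⟩ ⟨l'', h1⟩ (hd.trans h3.symm)
    rw [hi] at h1
    cases h1
    exact hn (hl' ▸ h2)
  | forallFuture =>
    simp only [backward, Holds, holds_all, holds_onSym, holds_imp, holds_sym,
      DataQuantifier.Ranges]
    constructor
    · intro l j _
      by_cases h : ∃ c, w.sym c = cancel l ∧ w.datum j = w.datum c
      · right
        obtain ⟨c, hc, hjc⟩ := h
        obtain ⟨i, -, l', h1, h2, h3⟩ := hB c l hc
        exact ⟨i, Nat.zero_le _, ⟨l', h1, h2⟩, hjc.trans h3.symm⟩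
      · left
        intro c _ hc hd
        exact h ⟨c, hc, hd⟩
    · rintro c ⟨l, hc⟩ i hci hi hd
      obtain ⟨j, hj, l', h1, h2, h3⟩ := hB c l hc
      obtain rfl := huniq i j hi ⟨l', h1⟩ (hd.symm.trans h3.symm)
      exact absurd hj (not_lt.2 hci)

theorem overAlphabet_formula (n : ℕ) :
    (G.formula n : Formula op).OverAlphabet (RunLetter.num Λ) := by
  have hi : ∀ n, (G.input n : Formula op).OverAlphabet (RunLetter.num Λ) := by
    intro n
    induction n with
    | zero => exact overAlphabet_sym _
    | succ n ih =>
      simp only [input, OverAlphabet, overAlphabet_imp, noLinkAhead, ih, overAlphabet_sym, and_self]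
  refine ⟨⟨?_, ?_⟩, hi n⟩
  · refine overAlphabet_conj fun φ hφ => ?_
    simp only [List.mem_cons, List.not_mem_nil, or_false] at hφ
    rcases hφ with rfl | rfl | rfl | rfl | rfl | rfl | rfl | rfl | rfl | rfl | rfl
    all_goals first
      | refine overAlphabet_all fun l => ?_
        simp only [OverAlphabet, overAlphabet_imp, overAlphabet_onSym, overAlphabet_sym,
          visitAhead, noLinkAhead, linkAhead, and_self]
      | simp only [OverAlphabet, overAlphabet_imp, overAlphabet_onSym, overAlphabet_sym,
          visitAhead, linkAhead, and_self]
  · cases op with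
    | existsPast =>
      refine ⟨by simp only [OverAlphabet, overAlphabet_sym, and_self],
        overAlphabet_all fun l => ?_⟩
      simp only [OverAlphabet, overAlphabet_imp, overAlphabet_onSym]
    | forallFuture =>
      refine ⟨overAlphabet_all fun l => ?_, ?_⟩ <;>
      simp only [OverAlphabet, overAlphabet_imp, overAlphabet_onSym, overAlphabet_sym, and_self]

end CounterGraph

namespace CounterGraph

open Formula RunLetter
open Function (update)

/-! ### Data words satisfying the formula yield halting runs -/

variable {Λ : Type} {G : CounterGraph Λ} [Fintype Λ] {D : Type*} {w : DataWord (RunLetter.num Λ) D}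

variable (w) in
/-- The visit of `l` is announced at position `p`, with a datum not yet used for visits. -/
def Announces (p : Fin w.len) (l : Λ) : Prop :=
  w.sym p = visit l ∧ ∀ q < p, IsVisit (w.sym q) → w.datum q ≠ w.datum p

variable (G w) in
/-- The visit of `l'` announced at `p'` follows the visit of `l` announced at `p`. -/
structure Follows (p : Fin w.len) (l : Λ) (p' : Fin w.len) (l' : Λ) : Prop where
  left : Announces w p l
  right : Announces w p' l'
  lt : p < p'
  next : G.next l l'
  between : ∀ q, p < q → q < p' → IsVisit (w.sym q) → w.sym q = visit l ∧ w.datum p = w.datum q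
  ne : w.datum p ≠ w.datum p'
  link : ∃ k, p' ≤ k ∧ w.sym k = link ∧ w.datum p = w.datum k

/-- The successor `p'` is the first visit after `p` with another datum. It is not after the witness
`u`, so the `link` of `p` is still ahead of it and `next` applies. Its datum is new, since a block
of equal visits starting before `p` would have to pass through `p`. -/
theorem Describes.exists_follows (h : G.Describes w) {p : Fin w.len} {l : Λ}
    (hp : Announces w p l) (hl : G.instr l ≠ none) : ∃ p' l', G.Follows w p l p' l' := by
  obtain ⟨u, hpu, hu, hne, k, huk, hk, hdk⟩ := h.exists_visit p ⟨l, hp.1, hl⟩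
  obtain ⟨p', ⟨hpp', ⟨l', hl'⟩, hne'⟩, hmin⟩ := WellFounded.has_min wellFounded_lt
    {q | p ≤ q ∧ IsVisit (w.sym q) ∧ w.datum p ≠ w.datum q} ⟨u, hpu, hu, hne⟩
  have hp'u : p' ≤ u := not_lt.1 (hmin u ⟨hpu, hu, hne⟩)
  have hlt : p < p' := hpp'.lt_of_ne (by rintro rfl; exact hne' rfl)
  have hbet : ∀ q, p < q → q < p' → IsVisit (w.sym q) → w.datum p = w.datum q := by
    intro q hpq hqp' hq
    by_contra hn
    exact hmin q ⟨hpq.le, hq, hn⟩ hqp'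
  refine ⟨p', l', hp, ⟨hl', fun q hq hv hd => ?_⟩, hlt, ?_, fun q hpq hqp' hq => ?_, hne', k,
    hp'u.trans huk, hk, hdk⟩
  · rcases lt_trichotomy q p with hqp | rfl | hqp
    · obtain ⟨m, hm⟩ := hv
      rcases h.fresh m q hm p hqp.le with h1 | h1
      · exact hne' (h1.2.symm.trans hd)
      · exact h1 p' hlt.le ⟨l', hl'⟩ hd
    · exact hne' hd
    · exact hne' ((hbet q hqp hq hv).trans hd)
  · by_contra hn
    rcases h.next l p hp.1 p' hlt.le ⟨l', hl', hn⟩ with h1 | h1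
    exacts [hne' h1, h1 k (hp'u.trans huk) hk hdk]
  · have hd := hbet q hpq hqp' hq
    rcases h.fresh l p hp.1 q hpq.le with h1 | h1
    exacts [h1, absurd hd (h1 q le_rfl hq)]

variable (G w) in
/-- The data of increments of `r` before `p` that are not cancelled before `p`. -/
def live (r : ℕ) (p : Fin w.len) : Set D :=
  {x | (∃ q < p, (∃ l, w.sym q = visit l ∧ G.instr l = some (.inc r)) ∧ w.datum q = x) ∧
    ¬ ∃ q < p, (∃ l, w.sym q = cancel l ∧ G.instr l = some (.dec r)) ∧ w.datum q = x}

theorem finite_live (r : ℕ) (p : Fin w.len) : (G.live w r p).Finite :=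
  (Set.finite_range w.datum).subset fun _ ⟨⟨q, _, _, hq⟩, _⟩ => ⟨q, hq⟩

namespace Follows

variable {p p' : Fin w.len} {l l' : Λ}

theorem eq_of_visit (hF : G.Follows w p l p' l') {q : Fin w.len} {m : Λ} (hpq : p ≤ q)
    (hq : q < p') (hm : w.sym q = visit m) : m = l ∧ w.datum p = w.datum q := by
  rcases hpq.eq_or_lt with rfl | hpq
  · have := hF.left.1
    rw [hm] at this
    cases this
    exact ⟨rfl, rfl⟩
  · obtain ⟨h1, h2⟩ := hF.between q hpq hq ⟨m, hm⟩
    rw [hm] at h1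
    cases h1
    exact ⟨rfl, h2⟩

theorem eq_of_cancel (hF : G.Follows w p l p' l') (h : G.Describes w) {c : Fin w.len} {m : Λ}
    (hpc : p ≤ c) (hc : c < p') (hm : w.sym c = cancel m) : m = l ∧ G.IsDec l := by
  by_contra hn
  obtain ⟨k, hk, hlink, hd⟩ := hF.link
  rcases h.cancel_of_dec l p hF.left.1 c hpc ⟨m, hm, hn⟩ p' hc.le ⟨l', hF.right.1⟩ with h1 | h1
  exacts [hF.ne h1, h1 k hk hlink hd]

/-- The increments before the next visit are those before this visit, and possibly this one. -/
theorem exists_inc_iff (hF : G.Follows w p l p' l') (r : ℕ) (x : D) :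
    (∃ q < p', (∃ l, w.sym q = visit l ∧ G.instr l = some (.inc r)) ∧ w.datum q = x) ↔
      (∃ q < p, (∃ l, w.sym q = visit l ∧ G.instr l = some (.inc r)) ∧ w.datum q = x) ∨
        G.instr l = some (.inc r) ∧ x = w.datum p := by
  constructor
  · rintro ⟨q, hq, ⟨m, hm, hr⟩, rfl⟩
    rcases lt_or_ge q p with hqp | hqp
    · exact .inl ⟨q, hqp, ⟨m, hm, hr⟩, rfl⟩
    · obtain ⟨rfl, hd⟩ := hF.eq_of_visit hqp hq hm
      exact .inr ⟨hr, hd.symm⟩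
  · rintro (⟨q, hq, h⟩ | ⟨hr, rfl⟩)
    · exact ⟨q, hq.trans hF.lt, h⟩
    · exact ⟨p, hF.lt, ⟨l, hF.left.1, hr⟩, rfl⟩

theorem exists_cancel_iff_of_ne (hF : G.Follows w p l p' l') (h : G.Describes w) {r : ℕ}
    (hr : G.instr l ≠ some (.dec r)) (x : D) :
    (∃ q < p', (∃ l, w.sym q = cancel l ∧ G.instr l = some (.dec r)) ∧ w.datum q = x) ↔
      ∃ q < p, (∃ l, w.sym q = cancel l ∧ G.instr l = some (.dec r)) ∧ w.datum q = x := by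
  constructor
  · rintro ⟨q, hq, ⟨m, hm, hmr⟩, rfl⟩
    refine ⟨q, ?_, ⟨m, hm, hmr⟩, rfl⟩
    by_contra hqp
    obtain ⟨rfl, -⟩ := hF.eq_of_cancel h (not_lt.1 hqp) hq hm
    exact hr hmr
  · rintro ⟨q, hq, h⟩
    exact ⟨q, hq.trans hF.lt, h⟩

/-- A datum is cancelled during the visit of a decrementing node. -/
theorem exists_cancel (hF : G.Follows w p l p' l') (h : G.Describes w) (hl : G.IsDec l) :
    ∃ c, p < c ∧ c < p' ∧ w.sym c = cancel l := by
  obtain ⟨c, hpc, hc, u, hcu, hu, hne, k, huk, hk, hd⟩ := h.exists_cancel l p ⟨hF.left.1, hl⟩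
  have hpc : p < c := hpc.lt_of_ne (by rintro rfl; rw [hF.left.1] at hc; cases hc)
  refine ⟨c, hpc, ?_, hc⟩
  by_contra hp'c
  rw [not_lt] at hp'c
  -- Suppose `p' ≤ c`, and let `e` be the last visit up to `c`. The `link` of `p` is ahead of `e`,
  -- so its node `m` succeeds `l`, and `m ≠ l` as a decrementing node never follows itself. The
  -- visit at `u` shows that `e` does not halt, so `e` has a successor witness, necessarily after
  -- `c`; this makes `cancel l` at `c` illegal.
  obtain ⟨e, ⟨hec, ⟨m, hm⟩⟩, hmax⟩ := WellFounded.has_min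
    (wellFounded_gt (α := Fin w.len)) {q | q ≤ c ∧ IsVisit (w.sym q)} ⟨p', hp'c, l', hF.right.1⟩
  have hmax : ∀ q, q ≤ c → IsVisit (w.sym q) → q ≤ e :=
    fun q h1 h2 => not_lt.1 (hmax q ⟨h1, h2⟩)
  have hp'e : p' ≤ e := hmax p' hp'c ⟨l', hF.right.1⟩
  have hlem : G.next l m := by
    by_contra hn
    rcases h.next l p hF.left.1 e (hF.lt.le.trans hp'e) ⟨m, hm, hn⟩ with h1 | h1
    · rcases h.fresh l p hF.left.1 p' hF.lt.le with h2 | h2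
      · exact hF.ne h2.2
      · exact h2 e hp'e ⟨m, hm⟩ h1
    · exact h1 k (hec.trans (hcu.trans huk)) hk hd
  have hml : m ≠ l := by
    rintro rfl
    obtain ⟨r, hr⟩ := hl
    exact G.not_next_self m r hr hlem
  have hue : w.datum e ≠ w.datum u := by
    rcases h.fresh m e hm c hec with h2 | h2
    · rw [h2.1] at hc; cases hc
    · exact h2 u hcu hu
  by_cases hmh : G.instr m = none
  · exact hue (h.last e ⟨m, hm, hmh⟩ u (hec.trans hcu) hu)
  · obtain ⟨u', heu', hu', hne', k', huk', hk', hd'⟩ := h.exists_visit e ⟨m, hm, hmh⟩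
    have hcu' : c ≤ u' := by
      by_contra hn
      have := hmax u' (not_le.1 hn).le hu'
      obtain rfl := le_antisymm this heu'
      exact hne' rfl
    rcases h.cancel_of_dec m e hm c hec ⟨l, hc, fun hn => hml hn.1.symm⟩ u' hcu' hu' with h2 | h2
    · exact hne' h2
    · exact h2 k' huk' hk' hd'

/-- The datum of `c` is marked after some visit `u`. If `u` came before `c'`, it would be a copy of
`p`, but `c` interrupts that block. So another datum at `c'` would precede the mark, against
`mark_le`. -/
theorem datum_cancel_eq (hF : G.Follows w p l p' l') (h : G.Describes w) {c c' : Fin w.len}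
    (hpc : p ≤ c) (hcc' : c ≤ c') (hc' : c' < p') (h1 : IsCancel (w.sym c))
    (h2 : IsCancel (w.sym c')) : w.datum c = w.datum c' := by
  rcases h.mark_le c h1 c' hcc' h2 with h3 | h3
  · exact h3
  · exfalso
    obtain ⟨u, hcu, ⟨m, hm⟩, k, huk, hk, hd⟩ := h.exists_mark c h1
    refine h3 k (le_trans ?_ huk) hk hd
    by_contra hn
    have hup' : u < p' := (not_le.1 hn).trans hc'
    obtain ⟨-, hdu⟩ := hF.eq_of_visit (hpc.trans hcu) hup' hm
    rcases h.fresh l p hF.left.1 c hpc with h4 | h4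
    · obtain ⟨m', hm'⟩ := h1
      rw [h4.1] at hm'
      cases hm'
    · exact h4 u hcu ⟨m, hm⟩ hdu

theorem live_eq_of_ne (hF : G.Follows w p l p' l') (h : G.Describes w) {r : ℕ}
    (hi : G.instr l ≠ some (.inc r)) (hd : G.instr l ≠ some (.dec r)) :
    G.live w r p' = G.live w r p := by
  ext x
  simp only [live, Set.mem_ofPred_eq, hF.exists_inc_iff, hF.exists_cancel_iff_of_ne h hd, hi,
    false_and, or_false]

/-- The new datum cannot have been cancelled already, since a cancellation is backed by an earlier
visit with its datum. -/
theorem live_inc (hF : G.Follows w p l p' l') (h : G.Describes w) (hB : G.Backed w) {r : ℕ}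
    (hi : G.instr l = some (.inc r)) :
    G.live w r p' = insert (w.datum p) (G.live w r p) ∧ w.datum p ∉ G.live w r p := by
  constructor
  · ext x
    simp only [live, Set.mem_ofPred_eq, Set.mem_insert_iff, hF.exists_inc_iff,
      hF.exists_cancel_iff_of_ne h (r := r) (by simp [hi]), hi, true_and]
    constructor
    · rintro ⟨h1 | h1, h2⟩
      exacts [.inr ⟨h1, h2⟩, .inl h1]
    · rintro (rfl | ⟨h1, h2⟩)
      · refine ⟨.inr rfl, ?_⟩
        rintro ⟨q, hq, ⟨m, hm, -⟩, hd⟩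
        obtain ⟨i, hi, m', hm', -, hd'⟩ := hB q m hm
        exact hF.left.2 i (hi.trans hq) ⟨m', hm'⟩ (hd'.trans hd)
      · exact ⟨.inl h1, h2⟩
  · rintro ⟨⟨q, hq, ⟨m, hm, -⟩, hd⟩, -⟩
    exact hF.left.2 q hq ⟨m, hm⟩ hd

/-- The cancelled datum stems from an increment before `p`, as visits between `p` and `c` are copies
of a decrement. `cancel_once` excludes an earlier cancellation, and `datum_cancel_eq` a second
datum. -/
theorem live_dec (hF : G.Follows w p l p' l') (h : G.Describes w) (hB : G.Backed w) {r : ℕ}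
    (hr : G.instr l = some (.dec r)) :
    ∃ x ∈ G.live w r p, G.live w r p' = G.live w r p \ {x} := by
  obtain ⟨c, hpc, hcp', hc⟩ := hF.exists_cancel h ⟨r, hr⟩
  refine ⟨w.datum c, ⟨?_, ?_⟩, ?_⟩
  · obtain ⟨i, hic, m, hm, ⟨l₁, r', h1, h2, h3⟩, hd⟩ := hB c l hc
    cases h1
    rw [hr] at h3
    cases h3
    refine ⟨i, ?_, ⟨m, hm, h2⟩, hd⟩
    by_contra hn
    obtain ⟨rfl, -⟩ := hF.eq_of_visit (not_lt.1 hn) (hic.trans hcp') hm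
    rw [hr] at h2
    cases h2
  · rintro ⟨q, hq, ⟨m, hm, -⟩, hd⟩
    exact h.cancel_once q ⟨m, hm⟩ p hq.le ⟨l, hF.left.1⟩ c hpc.le ⟨l, hc⟩ hd
  · ext x
    have key : (∃ q < p', (∃ l, w.sym q = cancel l ∧ G.instr l = some (.dec r)) ∧
        w.datum q = x) ↔ (∃ q < p, (∃ l, w.sym q = cancel l ∧ G.instr l = some (.dec r)) ∧
          w.datum q = x) ∨ x = w.datum c := by
      constructor
      · rintro ⟨q, hq, ⟨m, hm, hmr⟩, rfl⟩
        rcases lt_or_ge q p with hqp | hqp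
        · exact .inl ⟨q, hqp, ⟨m, hm, hmr⟩, rfl⟩
        · right
          rcases le_total q c with hqc | hqc
          · exact hF.datum_cancel_eq h hqp hqc hcp' ⟨m, hm⟩ ⟨l, hc⟩
          · exact (hF.datum_cancel_eq h hpc.le hqc hq ⟨l, hc⟩ ⟨m, hm⟩).symm
      · rintro (⟨q, hq, h⟩ | rfl)
        · exact ⟨q, hq.trans hF.lt, h⟩
        · exact ⟨c, hcp', ⟨l, hc, hr⟩, rfl⟩
    simp only [live, Set.mem_ofPred_eq, hF.exists_inc_iff, key, hr, Set.mem_sdiff,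
      Set.mem_singleton_iff]
    simp only [Option.some.injEq, reduceCtorEq, false_and, or_false, not_or]
    exact and_assoc.symm

end Follows

theorem Describes.live_eq_empty (h : G.Describes w) {p : Fin w.len} {l : Λ}
    (hp : w.sym p = visit l) {r : ℕ} (hr : G.instr l = some (.zero r)) : G.live w r p = ∅ := by
  rw [Set.eq_empty_iff_forall_notMem]
  rintro x ⟨⟨q, hq, ⟨m, hm, hmr⟩, rfl⟩, hx⟩
  have ht : G.Tests m (w.sym p) := ⟨l, r, hp, hmr, hr⟩
  rcases h.cancel_of_test m q hm with h1 | ⟨c, hqc, ⟨l₁, r', h1, h2, h3⟩, hd⟩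
  · exact h1 p hq.le ht
  · have hc : w.sym c = cancel l₁ := h1
    rw [hmr] at h2
    cases h2
    refine hx ⟨c, ?_, ⟨l₁, hc, h3⟩, hd.symm⟩
    by_contra hn
    exact h.cancel_le_test m q hm p hq.le ht c (not_lt.1 hn) ⟨l₁, r, h1, hmr, h3⟩ hd

/-- The counters described by the data word before position `p`. -/
noncomputable def countersAt (G : CounterGraph Λ) (w : DataWord (RunLetter.num Λ) D)
    (p : Fin w.len) : Counters := fun r => (G.live w r p).ncard

theorem Follows.step {p p' : Fin w.len} {l l' : Λ} (hF : G.Follows w p l p' l')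
    (h : G.Describes w) (hB : G.Backed w) {a : CounterOp} (ha : G.instr l = some a) :
    a.Step (G.countersAt w p) (G.countersAt w p') := by
  have hother : ∀ r, a ≠ .inc r → a ≠ .dec r → G.countersAt w p' r = G.countersAt w p r := by
    intro r h1 h2
    rw [countersAt, hF.live_eq_of_ne h (by rw [ha]; simpa using h1) (by rw [ha]; simpa using h2),
      countersAt]
  cases a with
  | inc r =>
    funext s
    by_cases hs : s = r
    · subst hs
      obtain ⟨h1, h2⟩ := hF.live_inc h hB ha
      rw [Function.update_self, countersAt, h1, Set.ncard_insert_of_notMem h2 (finite_live _ _),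
        countersAt]
    · rw [Function.update_of_ne hs, hother s (by simpa using Ne.symm hs) (by simp)]
  | dec r =>
    obtain ⟨x, hx, h1⟩ := hF.live_dec h hB ha
    refine ⟨(Set.ncard_ne_zero_of_mem hx (finite_live _ _)), ?_⟩
    funext s
    by_cases hs : s = r
    · subst hs
      rw [Function.update_self, countersAt, h1, Set.ncard_sdiff_singleton_of_mem hx, countersAt]
    · rw [Function.update_of_ne hs, hother s (by simp) (by simpa using Ne.symm hs)]
  | zero r =>
    refine ⟨funext fun s => hother s (by simp) (by simp), ?_⟩
    rw [countersAt, h.live_eq_empty hF.left.1 ha, Set.ncard_empty]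

/-- The word is finite, so the chain of successors ends, and it can end only at a halting node. -/
theorem Describes.haltsFrom (h : G.Describes w) (hB : G.Backed w) {p : Fin w.len} {l : Λ}
    (hp : Announces w p l) : G.HaltsFrom l (G.countersAt w p) := by
  induction p using WellFoundedGT.induction generalizing l with
  | ind p ih =>
    cases ha : G.instr l with
    | none => exact .halt ha
    | some a =>
      obtain ⟨p', l', hF⟩ := h.exists_follows hp (by simp [ha])
      exact .step ha (hF.step h hB ha) hF.next (ih p' hF.lt hF.right)

/-- Each of the `n` visits of `init` adds one to counter `0` before a start node is reached. -/
theorem Describes.exists_haltsFrom_of_input (h : G.Describes w) (hB : G.Backed w)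
    {op : DataQuantifier} {n : ℕ} {p : Fin w.len} {l : Λ} (hp : Announces w p l) {d : D}
    (hn : (G.input n : Formula op).Holds w p d) :
    ∃ l, G.start l ∧
      G.HaltsFrom l (update (G.countersAt w p) 0 (G.countersAt w p 0 + n)) := by
  induction n generalizing p l d with
  | zero =>
    obtain ⟨l', hl', hs⟩ := holds_input_zero.1 hn
    rw [hp.1] at hl'
    cases hl'
    exact ⟨l, hs, by simpa using h.haltsFrom hB hp⟩
  | succ n ih =>
    obtain ⟨h1, h2⟩ := holds_input_succ.1 hn
    rw [hp.1] at h1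
    cases h1
    obtain ⟨p', l', hF⟩ := h.exists_follows hp (by simp [G.instr_init])
    obtain ⟨k, hk, hk', hd⟩ := hF.link
    have h3 : (G.input n : Formula op).Holds w p' (w.datum p) := by
      rcases h2 p' hF.lt.le ⟨l', hF.right.1⟩ with h3 | h3 | h3
      exacts [absurd h3 hF.ne, absurd hd (h3 k hk hk'), h3]
    obtain ⟨m, hm, hm'⟩ := ih hF.right h3
    have hs : G.countersAt w p' = _ := hF.step h hB G.instr_init
    refine ⟨m, hm, ?_⟩
    rw [hs] at hm'
    simpa [add_assoc, add_comm 1] using hm'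

theorem halts_of_satisfiable {op : DataQuantifier} {n : ℕ}
    (hs : (G.formula n : Formula op).Satisfiable D (RunLetter.num Λ)) : G.Halts n := by
  obtain ⟨w, ⟨h, hB⟩, hn⟩ := hs
  have h := holds_core_iff.1 h
  have hB := backed_of_holds hB
  have hv : ∃ l, w.sym w.first = visit l := by
    cases n with
    | zero =>
      obtain ⟨l, hl, -⟩ := holds_input_zero.1 hn
      exact ⟨l, hl⟩
    | succ n => exact ⟨_, (holds_input_succ.1 hn).1⟩
  obtain ⟨l, hl⟩ := hv
  have hfirst : ∀ q, ¬ q < w.first := fun q => Nat.not_lt_zero _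
  have := h.exists_haltsFrom_of_input hB ⟨hl, fun q hq => absurd hq (hfirst q)⟩ hn
  have h0 : G.countersAt w w.first = 0 := by
    funext r
    simp [countersAt, live, hfirst]
  simpa [h0, Halts] using this

end CounterGraph

namespace CounterGraph

open Formula RunLetter
open Function (update)

/-! ### Halting runs yield data words satisfying the formula -/

variable {Λ : Type} {G : CounterGraph Λ}

/-- A halting run that visits the nodes `s 0, …, s N` with counters `u 0, …, u N`. -/
structure IsRun (G : CounterGraph Λ) (N : ℕ) (s : ℕ → Λ) (u : ℕ → Counters) : Prop where
  step : ∀ i < N, ∃ a, G.instr (s i) = some a ∧ a.Step (u i) (u (i + 1)) ∧ G.next (s i) (s (i + 1))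
  halt : G.instr (s N) = none

theorem IsRun.cons {N : ℕ} {s : ℕ → Λ} {u : ℕ → Counters} (h : G.IsRun N s u) {l : Λ}
    {v : Counters} {a : CounterOp} (ha : G.instr l = some a) (hv : a.Step v (u 0))
    (hn : G.next l (s 0)) :
    G.IsRun (N + 1) (fun i => i.casesOn l s) (fun i => i.casesOn v u) where
  step i hi := by
    cases i with
    | zero => exact ⟨a, ha, hv, hn⟩
    | succ i => exact h.step i (by omega)
  halt := h.halt

theorem HaltsFrom.exists_isRun {l : Λ} {v : Counters} (h : G.HaltsFrom l v) :
    ∃ N s u, G.IsRun N s u ∧ s 0 = l ∧ u 0 = v := by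
  induction h with
  | @halt l v h => exact ⟨0, fun _ => l, fun _ => v, ⟨by simp, h⟩, rfl, rfl⟩
  | @step l a v v' l' ha hv hn _ ih =>
    obtain ⟨N, s, u, h, rfl, rfl⟩ := ih
    exact ⟨_, _, _, h.cons ha hv hn, rfl, rfl⟩

theorem HaltsFrom.exists_isRun_of_input {l : Λ} (hl : G.start l) {n : ℕ} {v : Counters}
    (h : G.HaltsFrom l (update v 0 (v 0 + n))) :
    ∃ N s u, G.IsRun N s u ∧ u 0 = v ∧ n ≤ N ∧ (∀ i < n, s i = G.init) ∧ G.start (s n) := by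
  induction n generalizing v with
  | zero =>
    obtain ⟨N, s, u, hr, rfl, hu⟩ := h.exists_isRun
    exact ⟨N, s, u, hr, by simpa using hu, by simp, by simp, hl⟩
  | succ n ih =>
    obtain ⟨N, s, u, h, hu, hN, hi, hs⟩ := ih (v := update v 0 (v 0 + 1))
      (by simpa [add_assoc, add_comm 1] using h)
    refine ⟨_, _, _, h.cons G.instr_init hu (G.next_init _), rfl, by omega, fun i hi' => ?_, hs⟩
    cases i with
    | zero => rfl
    | succ i => exact hi i (by omega)

open Classical in
/-- The earlier visit whose increment is cancelled by the decrement at the `i`-th visit; the `i`-th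
visit itself if it does not decrement a counter. -/
noncomputable def token (G : CounterGraph Λ) (s : ℕ → Λ) (i : ℕ) : ℕ :=
  match G.instr (s i) with
  -- First in, first out: the `k`-th decrement of `r` takes the `k`-th increment of `r`.
  | some (.dec r) => Nat.nth (fun j => G.instr (s j) = some (.inc r))
      (Nat.count (fun j => G.instr (s j) = some (.dec r)) i)
  | _ => i

theorem token_of_not_isDec {s : ℕ → Λ} {i : ℕ} (h : ¬ G.IsDec (s i)) : G.token s i = i := by
  rw [token]
  split
  · exact absurd ⟨_, ‹_›⟩ h
  · rfl

namespace IsRun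

variable {N : ℕ} {s : ℕ → Λ} {u : ℕ → Counters}

open Classical in
theorem token_of_dec {i r : ℕ} (h : G.instr (s i) = some (.dec r)) :
    G.token s i = Nat.nth (fun j => G.instr (s j) = some (.inc r))
      (Nat.count (fun j => G.instr (s j) = some (.dec r)) i) := by
  rw [token, h]

theorem lt_of_instr (h : G.IsRun N s u) {i : ℕ} (hi : i ≤ N) (hs : G.instr (s i) ≠ none) :
    i < N := by
  refine hi.lt_of_ne ?_
  rintro rfl
  exact hs h.halt

theorem eq_of_instr (h : G.IsRun N s u) {i : ℕ} (hi : i ≤ N) (hs : G.instr (s i) = none) :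
    i = N := by
  by_contra hne
  obtain ⟨a, ha, -⟩ := h.step i (by omega)
  simp [hs] at ha

open Classical in
theorem counters_add_count (h : G.IsRun N s u) (h0 : u 0 = 0) {i : ℕ} (hi : i ≤ N) (r : ℕ) :
    u i r + Nat.count (fun j => G.instr (s j) = some (.dec r)) i =
      Nat.count (fun j => G.instr (s j) = some (.inc r)) i := by
  induction i with
  | zero => simp [h0]
  | succ i ih =>
    have ih := ih (by omega)
    obtain ⟨a, ha, hstep, -⟩ := h.step i (by omega)
    rw [Nat.count_succ, Nat.count_succ, ha]
    cases a with
    | inc q =>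
      rw [show u (i + 1) = _ from hstep]
      by_cases hq : q = r
      · subst hq; simp; omega
      · simp [hq, Function.update_of_ne (Ne.symm hq), ih]
    | dec q =>
      obtain ⟨hne, hstep⟩ := hstep
      rw [hstep]
      by_cases hq : q = r
      · subst hq; simp; omega
      · simp [hq, Function.update_of_ne (Ne.symm hq), ih]
    | zero q =>
      rw [hstep.1]
      simp [ih]

open Classical in
-- A decrement meets a nonzero counter. Hence the `Nat.nth` in `token` is a genuine earlier
-- increment and not a default value.
theorem count_lt_count (h : G.IsRun N s u) (h0 : u 0 = 0) {i r : ℕ} (hi : i ≤ N)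
    (hr : G.instr (s i) = some (.dec r)) :
    Nat.count (fun j => G.instr (s j) = some (.dec r)) i <
      Nat.count (fun j => G.instr (s j) = some (.inc r)) i := by
  have h1 := h.counters_add_count h0 hi r
  obtain ⟨a, ha, hstep, -⟩ := h.step i (h.lt_of_instr hi (by simp [hr]))
  rw [hr] at ha
  cases ha
  have := hstep.1
  omega

theorem token_lt (h : G.IsRun N s u) (h0 : u 0 = 0) {i : ℕ} (hi : i ≤ N)
    (hd : G.IsDec (s i)) : G.token s i < i := by
  classical
  obtain ⟨r, hr⟩ := hd
  rw [token_of_dec hr]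
  exact Nat.nth_lt_of_lt_count (h.count_lt_count h0 hi hr)

theorem token_le (h : G.IsRun N s u) (h0 : u 0 = 0) {i : ℕ} (hi : i ≤ N) : G.token s i ≤ i := by
  by_cases hd : G.IsDec (s i)
  · exact (h.token_lt h0 hi hd).le
  · exact (token_of_not_isDec hd).le

theorem instr_token (h : G.IsRun N s u) (h0 : u 0 = 0) {i r : ℕ} (hi : i ≤ N)
    (hr : G.instr (s i) = some (.dec r)) : G.instr (s (G.token s i)) = some (.inc r) := by
  classical
  rw [token_of_dec hr]
  refine Nat.nth_mem (p := fun j => G.instr (s j) = some (.inc r)) _ fun hf => ?_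
  exact (h.count_lt_count h0 hi hr).trans_le (Nat.count_le_card hf i)

/-- If `j` does not decrement, its token is `j` itself, while that of `i` is below `i`. For two
decrements the token determines the counter and the rank. -/
theorem token_inj (h : G.IsRun N s u) (h0 : u 0 = 0) {i j : ℕ} (hij : i ≤ j) (hj : j ≤ N)
    (hi : G.IsDec (s i)) (he : G.token s i = G.token s j) : i = j := by
  classical
  by_cases hd : G.IsDec (s j)
  · obtain ⟨r, hr⟩ := hi
    obtain ⟨q, hq⟩ := hd
    have h1 := h.instr_token h0 (hij.trans hj) hr
    have h2 := h.instr_token h0 hj hq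
    rw [he, h2] at h1
    cases h1
    have h3 := h.count_lt_count h0 (hij.trans hj) hr
    have h4 := h.count_lt_count h0 hj hq
    rw [token_of_dec hr, token_of_dec hq] at he
    have h5 := congrArg (Nat.count fun j => G.instr (s j) = some (.inc r)) he
    rw [Nat.count_nth fun hf => h3.trans_le (Nat.count_le_card hf i),
      Nat.count_nth fun hf => h4.trans_le (Nat.count_le_card hf j)] at h5
    exact Nat.count_injective hr hq h5
  · have := h.token_lt h0 (hij.trans hj) hi
    rw [he, token_of_not_isDec hd] at this
    omega

/-- At a zero test there have been as many decrements of `r` as increments, so the rank of the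
increment at `j` is also that of a decrement before `i`. -/
theorem exists_token_eq (h : G.IsRun N s u) (h0 : u 0 = 0) {i j r : ℕ} (hi : i ≤ N) (hji : j < i)
    (hz : G.instr (s i) = some (.zero r)) (hj : G.instr (s j) = some (.inc r)) :
    ∃ k < i, G.instr (s k) = some (.dec r) ∧ G.token s k = j := by
  classical
  have h1 := h.counters_add_count h0 hi r
  obtain ⟨a, ha, hstep, -⟩ := h.step i (h.lt_of_instr hi (by simp [hz]))
  rw [hz] at ha
  cases ha
  rw [hstep.2, zero_add] at h1
  have h2 : Nat.count (fun j => G.instr (s j) = some (.inc r)) j <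
      Nat.count (fun j => G.instr (s j) = some (.dec r)) i := by
    rw [h1]
    exact Nat.count_strict_mono hj hji
  have h3 : ∀ hf : (Set.ofPred fun j => G.instr (s j) = some (.dec r)).Finite,
      Nat.count (fun j => G.instr (s j) = some (.inc r)) j < hf.toFinset.card :=
    fun hf => h2.trans_le (Nat.count_le_card hf i)
  have h4 := Nat.nth_mem (p := fun j => G.instr (s j) = some (.dec r)) _ h3
  refine ⟨_, Nat.nth_lt_of_lt_count h2, h4, ?_⟩
  rw [token_of_dec h4, Nat.count_nth h3]
  exact Nat.nth_count (p := fun j => G.instr (s j) = some (.inc r)) hj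

end IsRun

end CounterGraph

/-! ### The canonical data word of a run -/

namespace CounterGraph

open Formula RunLetter
open Function (update)

variable {Λ : Type} {G : CounterGraph Λ} {D : Type*}

open Classical in
/-- The letter at position `p` of the data word describing a run. Every visit occupies four
positions. -/
noncomputable def runLetter (G : CounterGraph Λ) (s : ℕ → Λ) (p : ℕ) : RunLetter Λ :=
  if p % 4 = 0 then visit (s (p / 4))
  else if p % 4 = 1 then link
  else if p % 4 = 3 ∧ G.IsDec (s (p / 4)) then cancel (s (p / 4))
  else mark

/-- The datum at position `p` of the data word describing a run, as the number of a visit. -/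
noncomputable def runDatum (G : CounterGraph Λ) (s : ℕ → Λ) (p : ℕ) : ℕ :=
  if p % 4 = 0 then p / 4
  -- At visit `0` the truncated subtraction repeats datum `0`; this `link` comes before any other
  -- visit and is harmless.
  else if p % 4 = 1 then p / 4 - 1
  else if p % 4 = 2 then G.token s (p / 4 - 1)
  else G.token s (p / 4)

theorem runLetter_eq_visit {s : ℕ → Λ} {p : ℕ} {l : Λ} (h : G.runLetter s p = visit l) :
    ∃ i, p = 4 * i ∧ l = s i ∧ G.runDatum s p = i := by
  rw [runLetter] at h
  split_ifs at h with h1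
  cases h
  exact ⟨p / 4, by omega, rfl, by rw [runDatum, if_pos h1]⟩

theorem runLetter_eq_link {s : ℕ → Λ} {p : ℕ} (h : G.runLetter s p = link) :
    ∃ i, p = 4 * i + 1 ∧ G.runDatum s p = i - 1 := by
  rw [runLetter] at h
  split_ifs at h with h1 h2
  exact ⟨p / 4, by omega, by rw [runDatum, if_neg h1, if_pos h2]⟩

theorem runLetter_eq_cancel {s : ℕ → Λ} {p : ℕ} {l : Λ} (h : G.runLetter s p = cancel l) :
    ∃ i, p = 4 * i + 3 ∧ l = s i ∧ G.IsDec (s i) ∧ G.runDatum s p = G.token s i := by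
  rw [runLetter] at h
  split_ifs at h with h1 h2 h3
  cases h
  exact ⟨p / 4, by omega, rfl, h3.2, by rw [runDatum, if_neg h1, if_neg h2, if_neg (by omega)]⟩

theorem runLetter_eq_mark {s : ℕ → Λ} {p : ℕ} (h : G.runLetter s p = mark) :
    ∃ i, (p = 4 * i + 2 ∧ G.runDatum s p = G.token s (i - 1)) ∨
      (p = 4 * i + 3 ∧ G.runDatum s p = i) := by
  rw [runLetter] at h
  split_ifs at h with h1 h2 h3
  refine ⟨p / 4, ?_⟩
  by_cases h4 : p % 4 = 2
  · exact .inl ⟨by omega, by rw [runDatum, if_neg h1, if_neg h2, if_pos h4]⟩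
  · refine .inr ⟨by omega, ?_⟩
    rw [runDatum, if_neg h1, if_neg h2, if_neg h4, token_of_not_isDec]
    exact fun hd => h3 ⟨by omega, hd⟩

theorem runLetter_visit (s : ℕ → Λ) (i : ℕ) :
    G.runLetter s (4 * i) = visit (s i) ∧ G.runDatum s (4 * i) = i := by
  rw [runLetter, runDatum, if_pos (by omega), if_pos (by omega), Nat.mul_div_cancel_left _ (by omega)]
  exact ⟨rfl, rfl⟩

theorem runLetter_link (s : ℕ → Λ) (i : ℕ) :
    G.runLetter s (4 * (i + 1) + 1) = link ∧ G.runDatum s (4 * (i + 1) + 1) = i := by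
  rw [runLetter, runDatum, if_neg (by omega), if_pos (by omega), if_neg (by omega),
    if_pos (by omega)]
  exact ⟨rfl, by omega⟩

theorem runLetter_mark (s : ℕ → Λ) (i : ℕ) :
    G.runLetter s (4 * (i + 1) + 2) = mark ∧
      G.runDatum s (4 * (i + 1) + 2) = G.token s i := by
  rw [runLetter, runDatum, if_neg (by omega), if_neg (by omega), if_neg (by omega),
    if_neg (by omega), if_neg (by omega), if_pos (by omega),
    show (4 * (i + 1) + 2) / 4 - 1 = i by omega]
  exact ⟨rfl, rfl⟩

theorem runLetter_cancel {s : ℕ → Λ} {i : ℕ} (h : G.IsDec (s i)) :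
    G.runLetter s (4 * i + 3) = cancel (s i) ∧ G.runDatum s (4 * i + 3) = G.token s i := by
  have e : (4 * i + 3) / 4 = i := by omega
  rw [runLetter, runDatum, e, if_neg (by omega), if_neg (by omega), if_pos ⟨by omega, h⟩,
    if_neg (by omega), if_neg (by omega), if_neg (by omega)]
  exact ⟨rfl, rfl⟩

variable [Fintype Λ]

/-- The data word describing a run that visits the nodes `s 0, …, s N`. -/
noncomputable def runWord (G : CounterGraph Λ) (e : ℕ ↪ D) (N : ℕ) (s : ℕ → Λ) :
    DataWord (RunLetter.num Λ) D where
  len := 4 * (N + 1)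
  len_pos := by omega
  letter p := RunLetter.equiv (G.runLetter s p)
  datum p := e (G.runDatum s p)

variable {e : ℕ ↪ D} {N : ℕ} {s : ℕ → Λ} {u : ℕ → Counters}

theorem sym_runWord (p : Fin (G.runWord e N s).len) :
    (G.runWord e N s).sym p = G.runLetter s p :=
  RunLetter.equiv.symm_apply_apply _

theorem datum_runWord_inj {p q : Fin (G.runWord e N s).len} :
    (G.runWord e N s).datum p = (G.runWord e N s).datum q ↔ G.runDatum s p = G.runDatum s q :=
  e.injective.eq_iff

namespace IsRun

/-- The `link` with datum `i` is ahead of a later visit `j` only for `j = i + 1`. With the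
injectivity of tokens, the conditions reduce to arithmetic on blocks of four positions. -/
theorem describes (h : G.IsRun N s u) (h0 : u 0 = 0) : G.Describes (G.runWord e N s) := by
  have hlen : ∀ p : Fin (G.runWord e N s).len, (p : ℕ) < 4 * (N + 1) := fun p => p.2
  have hnext : ∀ i, i + 1 ≤ N → G.next (s i) (s (i + 1)) := by
    intro i hi
    obtain ⟨a, -, -, h⟩ := h.step i hi
    exact h
  have hdec : ∀ i, i ≤ N → G.IsDec (s i) → i + 1 ≤ N := by
    rintro i hi ⟨r, hr⟩
    exact h.lt_of_instr hi (by simp [hr])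
  constructor <;> simp only [sym_runWord, datum_runWord_inj, IsVisit, IsCancel, Fin.le_def, ne_eq]
  · rintro p ⟨l, hl, hn⟩
    obtain ⟨i, hp, rfl, hi⟩ := runLetter_eq_visit hl
    have hiN : i + 1 ≤ N := h.lt_of_instr (by have := hlen p; omega) hn
    obtain ⟨v1, v2⟩ := runLetter_visit (G := G) s (i + 1)
    obtain ⟨k1, k2⟩ := runLetter_link (G := G) s i
    exact ⟨⟨4 * (i + 1), show _ < 4 * (N + 1) by omega⟩, by simp only; omega, ⟨_, v1⟩,
      by simp only [hi, v2]; omega, ⟨4 * (i + 1) + 1, show _ < 4 * (N + 1) by omega⟩,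
      by simp, k1, by simp only [hi, k2]⟩
  · rintro l p hl q hpq ⟨l', hl', hn⟩
    obtain ⟨i, hp, rfl, hi⟩ := runLetter_eq_visit hl
    obtain ⟨j, hq, rfl, hj⟩ := runLetter_eq_visit hl'
    rw [hi, hj, or_iff_not_imp_left]
    intro hij k hqk hk he
    obtain ⟨m, hm, hm'⟩ := runLetter_eq_link hk
    have hji : j = i + 1 := by omega
    subst hji
    exact hn (hnext i (by have := hlen q; omega))
  · rintro l p hl q hpq
    obtain ⟨i, hp, rfl, hi⟩ := runLetter_eq_visit hl
    by_cases hqp : (q : ℕ) = p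
    · exact .inl ⟨by rw [hqp, hl], by rw [hqp]⟩
    · right
      rintro k hqk ⟨l', hl'⟩ he
      obtain ⟨j, hk, -, hj⟩ := runLetter_eq_visit hl'
      omega
  · rintro l p ⟨hl, hd⟩
    obtain ⟨i, hp, rfl, hi⟩ := runLetter_eq_visit hl
    have hiN := hdec i (by have := hlen p; omega) hd
    obtain ⟨c1, c2⟩ := runLetter_cancel hd
    obtain ⟨v1, v2⟩ := runLetter_visit (G := G) s (i + 1)
    obtain ⟨k1, k2⟩ := runLetter_link (G := G) s i
    exact ⟨⟨4 * i + 3, show _ < 4 * (N + 1) by omega⟩, by simp only; omega, c1,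
      ⟨4 * (i + 1), show _ < 4 * (N + 1) by omega⟩, by simp only; omega, ⟨_, v1⟩,
      by simp only [hi, v2]; omega, ⟨4 * (i + 1) + 1, show _ < 4 * (N + 1) by omega⟩,
      by simp, k1, by simp only [hi, k2]⟩
  · rintro l p hl c hpc ⟨l', hl', hn⟩ q hcq ⟨l'', hl''⟩
    obtain ⟨i, hp, rfl, hi⟩ := runLetter_eq_visit hl
    obtain ⟨j, hc, rfl, hd, -⟩ := runLetter_eq_cancel hl'
    obtain ⟨q', hq, -, -⟩ := runLetter_eq_visit hl''
    right
    intro k hqk hk he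
    obtain ⟨m, hm, hm'⟩ := runLetter_eq_link hk
    have hij : i ≠ j := by rintro rfl; exact hn ⟨rfl, hd⟩
    omega
  · rintro c ⟨l, hl⟩
    obtain ⟨i, hc, rfl, hd, hi⟩ := runLetter_eq_cancel hl
    have hiN := hdec i (by have := hlen c; omega) hd
    obtain ⟨v1, v2⟩ := runLetter_visit (G := G) s (i + 1)
    obtain ⟨k1, k2⟩ := runLetter_mark (G := G) s i
    exact ⟨⟨4 * (i + 1), show _ < 4 * (N + 1) by omega⟩, by simp only; omega, ⟨_, v1⟩,
      ⟨4 * (i + 1) + 2, show _ < 4 * (N + 1) by omega⟩, by simp, k1, by simp only [hi, k2]⟩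
  · rintro c ⟨l, hl⟩ c' hcc' ⟨l', hl'⟩
    obtain ⟨i, hc, rfl, hd, hi⟩ := runLetter_eq_cancel hl
    obtain ⟨j, hc', rfl, hd', hj⟩ := runLetter_eq_cancel hl'
    rw [or_iff_not_imp_left]
    intro hne k hck hk he
    have hij : i ≠ j := by rintro rfl; exact hne (hi.trans hj.symm)
    have hlt := h.token_lt h0 (i := i) (by have := hlen c; omega) hd
    obtain ⟨m, ⟨hm, hm'⟩ | ⟨hm, hm'⟩⟩ := runLetter_eq_mark hk
    · have := h.token_inj h0 (i := i) (j := m - 1) (by omega) (by have := hlen k; omega) hd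
        (by omega)
      omega
    · omega
  · rintro c ⟨l, hl⟩ q hcq ⟨l', hl'⟩ c' hqc' ⟨l'', hl''⟩ he
    obtain ⟨i, hc, rfl, hd, hi⟩ := runLetter_eq_cancel hl
    obtain ⟨q', hq, -, -⟩ := runLetter_eq_visit hl'
    obtain ⟨j, hc', rfl, hd', hj⟩ := runLetter_eq_cancel hl''
    have := h.token_inj h0 (i := i) (j := j) (by omega) (by have := hlen c'; omega) hd (by omega)
    omega
  · rintro l p hl
    obtain ⟨i, hp, rfl, hi⟩ := runLetter_eq_visit hl
    rw [or_iff_not_imp_left]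
    intro hn
    push Not at hn
    obtain ⟨q, hpq, l', r, hl', hr, hr'⟩ := hn
    obtain ⟨j, hq, rfl, hj⟩ := runLetter_eq_visit hl'
    have hij : i ≠ j := by rintro rfl; rw [hr] at hr'; cases hr'
    obtain ⟨k, hkj, hk, ht⟩ := h.exists_token_eq h0 (i := j) (j := i) (by have := hlen q; omega)
      (by omega) hr' hr
    have hlt := h.token_lt h0 (i := k) (by have := hlen q; omega) ⟨r, hk⟩
    obtain ⟨c1, c2⟩ := runLetter_cancel (G := G) (s := s) ⟨r, hk⟩
    exact ⟨⟨4 * k + 3, show _ < 4 * (N + 1) by have := hlen q; omega⟩, by simp only; omega,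
      ⟨_, r, c1, hr, hk⟩, by simp only [hi, c2, ht]⟩
  · rintro l p hl q hpq ⟨l', r, hl', hr, hr'⟩ c hqc ⟨l'', r', hl'', hr1, hr2⟩ he
    obtain ⟨i, hp, rfl, hi⟩ := runLetter_eq_visit hl
    obtain ⟨j, hq, rfl, hj⟩ := runLetter_eq_visit hl'
    obtain ⟨m, hc, rfl, hd, hm⟩ := runLetter_eq_cancel hl''
    have hij : i ≠ j := by rintro rfl; rw [hr] at hr'; cases hr'
    obtain ⟨k, hkj, hk, ht⟩ := h.exists_token_eq h0 (i := j) (j := i) (by have := hlen q; omega)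
      (by omega) hr' hr
    have := h.token_inj h0 (i := k) (j := m) (by omega) (by have := hlen c; omega) ⟨r, hk⟩
      (by omega)
    omega
  · rintro p ⟨l, hl, hn⟩ q hpq ⟨l', hl'⟩
    obtain ⟨i, hp, rfl, hi⟩ := runLetter_eq_visit hl
    obtain ⟨j, hq, rfl, hj⟩ := runLetter_eq_visit hl'
    have := h.eq_of_instr (i := i) (by have := hlen p; omega) hn
    have := hlen q
    omega

theorem backed (h : G.IsRun N s u) (h0 : u 0 = 0) : G.Backed (G.runWord e N s) := by
  intro c l hl
  have hlen : (c : ℕ) < 4 * (N + 1) := c.2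
  simp only [sym_runWord, datum_runWord_inj, Fin.lt_def] at hl ⊢
  obtain ⟨i, hc, rfl, ⟨r, hr⟩, hi⟩ := runLetter_eq_cancel hl
  have hlt := h.token_lt h0 (i := i) (by omega) ⟨r, hr⟩
  obtain ⟨v1, v2⟩ := runLetter_visit (G := G) s (G.token s i)
  exact ⟨⟨4 * G.token s i, show _ < 4 * (N + 1) by omega⟩, by simp only; omega, _, v1,
    ⟨_, r, rfl, h.instr_token h0 (by omega) hr, hr⟩, by simp only [hi, v2]⟩

/-- The datum at `p` has a number at most `p / 4`, because tokens never exceed their visit, and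
visits carry their own numbers. -/
theorem exists_lt_of_not_isVisit (h : G.IsRun N s u) (h0 : u 0 = 0)
    (p : Fin (G.runWord e N s).len) (hp : ¬ IsVisit ((G.runWord e N s).sym p)) :
    ∃ q, q < p ∧ (G.runWord e N s).datum q = (G.runWord e N s).datum p := by
  have hlen : (p : ℕ) < 4 * (N + 1) := p.2
  rw [sym_runWord] at hp
  have hp4 : (p : ℕ) % 4 ≠ 0 := by
    intro h4
    exact hp ⟨_, if_pos h4⟩
  have hle : G.runDatum s p ≤ p / 4 := by
    have h1 := h.token_le h0 (i := p / 4) (by omega)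
    have h2 := h.token_le h0 (i := p / 4 - 1) (by omega)
    rw [runDatum]
    split_ifs <;> omega
  obtain ⟨-, v2⟩ := runLetter_visit (G := G) s (G.runDatum s p)
  refine ⟨⟨4 * G.runDatum s p, show _ < 4 * (N + 1) by omega⟩, ?_, ?_⟩
  · rw [Fin.lt_def]; simp only; omega
  · rw [datum_runWord_inj, v2]

theorem eq_of_isVisit {p q : Fin (G.runWord e N s).len} (hp : IsVisit ((G.runWord e N s).sym p))
    (hq : IsVisit ((G.runWord e N s).sym q))
    (h : (G.runWord e N s).datum p = (G.runWord e N s).datum q) : p = q := by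
  simp only [sym_runWord, datum_runWord_inj] at hp hq h
  obtain ⟨l, hl⟩ := hp
  obtain ⟨l', hl'⟩ := hq
  obtain ⟨i, hp, -, hi⟩ := runLetter_eq_visit hl
  obtain ⟨j, hq, -, hj⟩ := runLetter_eq_visit hl'
  exact Fin.ext (by omega)

theorem holds_input {op : DataQuantifier} {n m i : ℕ} (hs : G.start (s n))
    (hinit : ∀ i < n, s i = G.init) (hi : i + m = n) {p : Fin (G.runWord e N s).len}
    (hp : (p : ℕ) = 4 * i) {d : D} : (G.input m : Formula op).Holds (G.runWord e N s) p d := by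
  have hv := runLetter_visit (G := G) s i
  induction m generalizing i p d with
  | zero =>
    rw [holds_input_zero, sym_runWord, hp, hv.1]
    exact ⟨_, rfl, by rwa [show i = n by omega]⟩
  | succ m ih =>
    simp only [holds_input_succ, sym_runWord, datum_runWord_inj, Fin.le_def, IsVisit, ne_eq]
    refine ⟨by rw [hp, hv.1, hinit i (by omega)], ?_⟩
    rintro q hpq ⟨l, hl⟩
    obtain ⟨j, hq, rfl, hj⟩ := runLetter_eq_visit hl
    rw [hp, hv.2, hj, or_iff_not_imp_left]
    intro hij
    by_cases hji : j = i + 1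
    · exact .inr (ih (i := i + 1) (by omega) (by omega) (runLetter_visit s _))
    · left
      intro k hqk hk he
      obtain ⟨m', hm, hm'⟩ := runLetter_eq_link hk
      omega

end IsRun

theorem satisfiable_of_halts [Infinite D] {op : DataQuantifier} {n : ℕ} (hn : G.Halts n) :
    (G.formula n : Formula op).Satisfiable D (RunLetter.num Λ) := by
  obtain ⟨l, hl, h⟩ := hn
  obtain ⟨N, s, u, h, h0, -, hinit, hs⟩ :=
    HaltsFrom.exists_isRun_of_input hl (n := n) (v := 0) (by simpa using h)
  refine ⟨G.runWord (Infinite.natEmbedding D) N s, ⟨holds_core_iff.2 (h.describes h0), ?_⟩, ?_⟩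
  · exact holds_backward (h.backed h0) (h.exists_lt_of_not_isVisit h0)
      fun i j => IsRun.eq_of_isVisit
  · exact IsRun.holds_input hs hinit (i := 0) (by omega) rfl

/-! ### The reduction -/

theorem satProblem_formula_iff [Infinite D] {op : DataQuantifier} {n : ℕ} :
    SatProblem D op (RunLetter.num Λ, G.formula n) ↔ G.Halts n :=
  ⟨fun h => halts_of_satisfiable h.2, fun h => ⟨overAlphabet_formula n, satisfiable_of_halts h⟩⟩

end CounterGraph

/-! ### Computability of the reduction -/

namespace Formula

variable {op : DataQuantifier}

theorem primrec_eight_mul_add {α : Type*} [Primcodable α] {f : α → ℕ} (hf : Primrec f) (k : ℕ) :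
    Primrec fun x => 8 * f x + k + 2 :=
  Primrec.nat_add.comp (Primrec.nat_add.comp (Primrec.nat_mul.comp (Primrec.const 8) hf)
    (Primrec.const k)) (Primrec.const 2)

theorem primrec_freeze : Primrec (freeze : Formula op → Formula op) :=
  Primrec.encode_iff.1 (primrec_eight_mul_add Primrec.encode 2)

theorem primrec_globally : Primrec (globally : Formula op → Formula op) :=
  Primrec.encode_iff.1 (primrec_eight_mul_add Primrec.encode 4)

theorem primrec_and_left (ψ : Formula op) : Primrec fun φ => and ψ φ :=
  Primrec.encode_iff.1 (primrec_eight_mul_add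
    (Primrec₂.natPair.comp (Primrec.const (Encodable.encode ψ)) Primrec.encode) 6)

theorem primrec_or_left (ψ : Formula op) : Primrec fun φ => or ψ φ :=
  Primrec.encode_iff.1 (primrec_eight_mul_add
    (Primrec₂.natPair.comp (Primrec.const (Encodable.encode ψ)) Primrec.encode) 7)

end Formula

namespace CounterGraph

open Formula RunLetter

variable {Λ : Type} [Fintype Λ] {G : CounterGraph Λ}

/-- Everything but `input` is constant, and `input` recurses on `n` with only the right argument of
connectives varying. -/
theorem primrec_formula {op : DataQuantifier} : Primrec (G.formula : ℕ → Formula op) := by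
  refine (primrec_and_left _).comp ?_
  have hstep : Primrec fun φ : Formula op => Formula.and (sym (· = visit G.init))
      (freeze (globally (imp (Λ := Λ) IsVisit (.or test (.or (noLinkAhead (Λ := Λ)) φ))))) :=
    (primrec_and_left _).comp (primrec_freeze.comp (primrec_globally.comp
      ((primrec_or_left _).comp ((primrec_or_left _).comp (primrec_or_left _)))))
  refine (Primrec.nat_rec₁ (G.input 0) (hstep.comp Primrec.snd).to₂).of_eq fun n => ?_
  induction n with
  | zero => rfl
  | succ n ih => simp only [input, ← ih]

end CounterGraph

theorem not_computablePred_satProblem (D : Type*) [Infinite D] (op : DataQuantifier) :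
    ¬ ComputablePred (SatProblem D op) := by
  intro h
  obtain ⟨Λ, _, G, hG⟩ := CounterGraph.exists_not_computablePred_halts
  refine hG (ComputablePred.computable_of_manyOneReducible (q := SatProblem D op) ?_ h)
  exact ⟨fun n => (RunLetter.num Λ, G.formula n),
    (Computable.const _).pair CounterGraph.primrec_formula.to_comp,
    fun n => CounterGraph.satProblem_formula_iff.symm⟩

end RegLTL

theorem mainTheorem6 (D : Type*) [Infinite D] :
    ¬ ComputablePred (RegLTL.SatProblem D .existsPast) ∧
      ¬ ComputablePred (RegLTL.SatProblem D .forallFuture) :=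
  ⟨RegLTL.not_computablePred_satProblem D _, RegLTL.not_computablePred_satProblem D _⟩
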